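/- Let $d\ge 1$, $c>0$, $1<p<\infty$, let $\phi\in C^2(\mathbb R^d;\mathbb R)$ and $d\mu=e^{-\phi(x)}\,dx$. Suppose $(M,\epsilon)$ is a valid growth pair for $\phi$ and $p$: $M:\mathbb R^d\to\mathbb R^d$ is measurable, $\epsilon\ge 0$, and for all $x,y\in\mathbb R^d$ \[\left|\,\left|\tfrac12-\tfrac1p\right|\,|\phi(x)-\phi(y)|-\left|\tfrac{x-y}{c}\cdot M\!\left(\tfrac{x+y}{2c}\right)\right|\,\right|\le\epsilon .\] Definitions. Let $\mathcal D_{\infty,1}$ be the space of (classes of) measurable $g:\mathbb R^{2d}\to\mathbb C$ for which there is a dominating $G\in L^1(\mathbb R^d)$, i.e. $|g(x,k)|<G(k)$ for a.e. $(x,k)$. Let $HS_0(M)$ be the set of $a\in L^\infty(\mathbb R^{2d})$ for which there is a unique $g_a\in\mathcal D_{\infty,1}$ such that for a.e. $x\in\mathbb R^d$ the Fourier transform of the tempered distribution $a(x,\cdot)$ is (integration against) the function \[k\mapsto \mathcal F_2a(x,k):=(2\pi)^{d/2}e^{-|M(x)\cdot k|}g_a(x,k),\] where $\langle\mathcal F\sigma,\psi\rangle=\langle\sigma,\mathcal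 F\psi\rangle$ and $\mathcal F\psi(k)=(2\pi)^{-d/2}\int\psi(\xi)e^{-i k\cdot\xi}\,d\xi$ for Schwartz $\psi$. Let $B$ be the set of $b\in L^\infty(\mathbb R^{2d})$ that do not depend on $\xi$, i.e. $b(x,\xi)=b(x)$ a.e., and let $HS(M)=HS_0(M)\oplus B$. Let $\mathcal C_\phi=\{f: e^{-\phi/2}f\in C_c^\infty(\mathbb R^d;\mathbb C)\}$. For $a=a_0+a_b\in HS(M)$ with $a_0\in HS_0(M)$, $a_b\in B$, and for $f\in\mathcal C_\phi$, put \[(a(Q,P)f)(y)=\frac{1}{(2\pi)^{d/2}c^d}\int_{\mathbb R^d}\mathcal F_2a_0\!\left(\tfrac{x+y}{2c},\tfrac{x-y}{c}\right)e^{\frac12(\phi(y)-\phi(x))}f(x)\,dx+a_b(y/c)f(y).\] A set $\mathcal T$ of bounded operators on a Banach space $X$ is R-bounded if there is $C\ge0$ such that for all $N$, all $T_1,\dots,T_N\in\mathcal T$ and all $x_1,\dots,x_N\in X$, \[\Big(\mathbb E\big\|\textstyle\sum_n\varepsilon_nT_nx_n\big\|^2\Big)^{1/2}\le C\Big(\mathbb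 E\big\|\textstyle\sum_n\varepsilon_nx_n\big\|^2\Big)^{1/2},\] where $\varepsilon_1,\dots,\varepsilon_N$ are independent random signs, uniformly distributed on $\{1,-1\}$. Theorem. Let $A\subset HS(M)$, and let $G\subset\mathcal D_{\infty,1}$ and $A_B\subset B$ be the sets of the functions $g_{a_0}$ and $a_b$ that correspond to the elements $a=a_0+a_b$ of $A$. Suppose that for each $g\in G$ a dominating $G_g\in L^1(\mathbb R^d)$ can be chosen such that \[\sup_{g\in G}\int_{\mathbb R^d}\operatorname*{ess\,sup}_{|y|\ge|x|}|G_g(y)|\,dx<\infty,\] and that $\sup_{b\in A_B}\|b\|_{L^\infty}<\infty$. Then for every $a\in A$ the operator $a(Q,P)$ extends uniquely from $\mathcal C_\phi$ to a bounded operator on $L^p(\mu)$, and the family $A(Q,P)=\{a(Q,P):a\in A\}$ is R-bounded on $L^p(\mu)$. -/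

import Mathlib

open MeasureTheory
open scoped ENNReal NNReal ContDiff

noncomputable section

namespace WeylHS

/-- The space `ℝ^d` with its Euclidean norm and Lebesgue measure. -/
abbrev E (d : ℕ) : Type := EuclideanSpace ℝ (Fin d)

/-- The Banach space `L^∞(ℝ^{2d})`; a point of `ℝ^{2d}` is a pair `(x, ξ)`. -/
abbrev Linf (d : ℕ) : Type := Lp ℂ ∞ (volume : Measure (E d × E d))

/-- The measure `dμ = exp(-φ(x)) dx` associated with a potential `φ`. -/
def weightMeasure {d : ℕ} (φ : E d → ℝ) : Measure (E d) :=
  volume.withDensity fun x => ENNReal.ofReal (Real.exp (-φ x))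

/-- The core `𝒞_φ = U₂⁻¹ C_c^∞(ℝ^d)`, with `(U₂ f)(x) = f(x) exp(-φ(x)/2)`. -/
def core {d : ℕ} (φ : E d → ℝ) : Set (E d → ℂ) :=
  {f | ContDiff ℝ ∞ (fun x => f x * (Real.exp (-φ x / 2) : ℂ)) ∧
    HasCompactSupport fun x => f x * (Real.exp (-φ x / 2) : ℂ)}

/-- `G ∈ L¹(ℝ^d)` dominates `g`: `|g(x,k)| < G(k)` for almost every `(x,k)`. -/
def Dominates {d : ℕ} (G : E d → ℝ) (g : E d × E d →ₘ[volume] ℂ) : Prop :=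
  Integrable G ∧ ∀ᵐ z : E d × E d, ‖g z‖ < G z.2

/-- The space `𝒟_{∞,1}` of `L¹`-dominated functions: (classes of) measurable functions on `ℝ^{2d}`
dominated by an integrable function of the second variable. Such a function is automatically in
`L^∞(ℝ^d; L¹(ℝ^d))`. -/
def DInfOne (d : ℕ) : Set (E d × E d →ₘ[volume] ℂ) :=
  {g | ∃ G : E d → ℝ, Dominates G g}

/-- The Fourier transform `(2π)^{-d/2} ∫ ψ(ξ) exp(-i k·ξ) dξ`. -/
def fourierInt {d : ℕ} (ψ : E d → ℂ) (k : E d) : ℂ :=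
  (((2 * Real.pi) ^ (-(d : ℝ) / 2) : ℝ) : ℂ) *
    ∫ ξ : E d, ψ ξ * Complex.exp (-Complex.I * ((inner ℝ k ξ : ℝ) : ℂ))

/-- The tempered distribution `I_a(x)`: `⟨I_a(x), ψ⟩ = ∫ a(x,ξ) ψ(ξ) dξ`. -/
def slicePairing {d : ℕ} (a : Linf d) (x : E d) (ψ : E d → ℂ) : ℂ :=
  ∫ ξ : E d, a (x, ξ) * ψ ξ

/-- The partial Fourier transform `(ℱ₂a)(x,k) = (2π)^{d/2} exp(-|M(x)·k|) g(x,k)` determined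
by `g = g_a`. -/
def partialFourier {d : ℕ} (M : E d → E d) (g : E d × E d →ₘ[volume] ℂ) (x k : E d) : ℂ :=
  (((2 * Real.pi) ^ ((d : ℝ) / 2) : ℝ) : ℂ) * (Real.exp (-|(inner ℝ (M x) k : ℝ)|) : ℂ) * g (x, k)

/-- `g ∈ 𝒟_{∞,1}` represents the symbol `a`: for almost every `x`, the Fourier transform of the
tempered distribution `I_a(x)`, given by `⟨ℱ σ, ψ⟩ = ⟨σ, ℱ ψ⟩`, is integration against
`(2π)^{d/2} exp(-|M(x)·k|) g(x,k)`. Since `a` and `g` are classes modulo null sets, the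
condition on `x` is imposed almost everywhere. -/
def Represents {d : ℕ} (M : E d → E d) (a : Linf d) (g : E d × E d →ₘ[volume] ℂ) : Prop :=
  g ∈ DInfOne d ∧ ∀ᵐ x : E d, ∀ ψ : SchwartzMap (E d) ℂ,
    slicePairing a x (fourierInt ψ) = ∫ k : E d, partialFourier M g x k * ψ k

/-- The symbol class `HS₀(M)`. -/
def HSZero {d : ℕ} (M : E d → E d) : Set (Linf d) :=
  {a | ∃! g, Represents M a g}

/-- `b(x,ξ) = β(x)` for almost every `(x,ξ)`. -/
def HasProfile {d : ℕ} (b : Linf d) (β : Lp ℂ ∞ (volume : Measure (E d))) : Prop :=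
  ∀ᵐ z : E d × E d, b z = β z.1

/-- The subspace `B` of the symbols in `L^∞(ℝ^{2d})` that do not depend on `ξ`. -/
def BSym (d : ℕ) : Set (Linf d) :=
  {b | ∃ β : Lp ℂ ∞ (volume : Measure (E d)), HasProfile b β}

/-- `a = a₀ + b` is a decomposition of `a` along `HS₀(M) ⊕ B`. -/
def Decomposes {d : ℕ} (M : E d → E d) (a a₀ b : Linf d) : Prop :=
  a₀ ∈ HSZero M ∧ b ∈ BSym d ∧ a = a₀ + b

/-- The symbol class `HS(M) = HS₀(M) ⊕ B`. -/
def HS {d : ℕ} (M : E d → E d) : Set (Linf d) :=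
  {a | ∃ a₀ b, Decomposes M a a₀ b}

/-- The set of the functions `g_a` that correspond to the `HS₀(M)`-parts of `a ∈ A`. -/
def gParts {d : ℕ} (M : E d → E d) (A : Set (Linf d)) : Set (E d × E d →ₘ[volume] ℂ) :=
  {g | ∃ a ∈ A, ∃ a₀ b, Decomposes M a a₀ b ∧ Represents M a₀ g}

/-- The set of the `B`-parts `a_b` of `a ∈ A`. -/
def bParts {d : ℕ} (M : E d → E d) (A : Set (Linf d)) : Set (Linf d) :=
  {b | ∃ a ∈ A, ∃ a₀, Decomposes M a a₀ b}

/-- `∫ esssup_{|y| ≥ |x|} |G(y)| dx`, the integral of the least radially decreasing majorant. -/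
def radialMajorantIntegral {d : ℕ} (G : E d → ℝ) : ℝ≥0∞ :=
  ∫⁻ x : E d, essSup (fun y => ‖G y‖ₑ) (volume.restrict {y : E d | ‖x‖ ≤ ‖y‖})

/-- The action of `a₀(Q,P)` for `a₀ ∈ HS₀(M)` with associated function `g`:
`(2π)^{-d/2} c^{-d} ∫ (ℱ₂a₀)((x+y)/(2c), (x-y)/c) exp((φ(y)-φ(x))/2) f(x) dx`. -/
def kernelAction {d : ℕ} (c : ℝ) (φ : E d → ℝ) (M : E d → E d)
    (g : E d × E d →ₘ[volume] ℂ) (f : E d → ℂ) (y : E d) : ℂ :=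
  (((2 * Real.pi) ^ (-(d : ℝ) / 2) * (c ^ d)⁻¹ : ℝ) : ℂ) *
    ∫ x : E d, partialFourier M g ((2 * c)⁻¹ • (x + y)) (c⁻¹ • (x - y)) *
      (Real.exp ((φ y - φ x) / 2) : ℂ) * f x

/-- `T` is a bounded extension to `L^p(μ)` of the operator `a(Q,P)` defined on `𝒞_φ`. For
`a = a₀ + b` the latter is the integral operator of `a₀` plus the multiplication by `b(y/c)`. -/
def IsWeylOperator {d : ℕ} (c : ℝ) (φ : E d → ℝ) (M : E d → E d) (p : ℝ≥0∞) [Fact (1 ≤ p)]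
    (a : Linf d) (T : Lp ℂ p (weightMeasure φ) →L[ℂ] Lp ℂ p (weightMeasure φ)) : Prop :=
  ∃ a₀ b g β, Decomposes M a a₀ b ∧ Represents M a₀ g ∧ HasProfile b β ∧
    ∀ f₀ ∈ core φ, ∀ f : Lp ℂ p (weightMeasure φ), f =ᵐ[weightMeasure φ] f₀ →
      T f =ᵐ[weightMeasure φ] fun y => kernelAction c φ M g f₀ y + β (c⁻¹ • y) * f₀ y

/-- The family `A(Q,P) = {a(Q,P) : a ∈ A}` of operators on `L^p(μ)`. -/
def weylFamily {d : ℕ} (c : ℝ) (φ : E d → ℝ) (M : E d → E d) (p : ℝ≥0∞) [Fact (1 ≤ p)]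
    (A : Set (Linf d)) : Set (Lp ℂ p (weightMeasure φ) →L[ℂ] Lp ℂ p (weightMeasure φ)) :=
  {T | ∃ a ∈ A, IsWeylOperator c φ M p a T}

/-- `(M, ε)` is a valid growth pair for `φ` and `p` (for `p = ∞`, `p.toReal⁻¹ = 0 = 1/p`). -/
def ValidGrowthPair {d : ℕ} (c : ℝ) (φ : E d → ℝ) (p : ℝ≥0∞) (M : E d → E d) (ε : ℝ) : Prop :=
  Measurable M ∧ 0 ≤ ε ∧ ∀ x y : E d,
    |(|1 / 2 - p.toReal⁻¹| * |φ x - φ y|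
      - |(inner ℝ (c⁻¹ • (x - y)) (M ((2 * c)⁻¹ • (x + y))) : ℝ)|)| ≤ ε

/-- The norm `(𝔼 ‖∑ₙ εₙ xₙ‖²)^{1/2}`, with independent uniformly distributed signs `εₙ ∈ {1,-1}`. -/
def rademacherNorm {X : Type*} [NormedAddCommGroup X] {N : ℕ} (x : Fin N → X) : ℝ :=
  Real.sqrt ((∑ s : Fin N → ℤˣ, ‖∑ n, (s n : ℤ) • x n‖ ^ 2) / 2 ^ N)

/-- R-boundedness of a family of bounded operators. -/
def RBounded {X Y : Type*} [NormedAddCommGroup X] [NormedSpace ℂ X]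
    [NormedAddCommGroup Y] [NormedSpace ℂ Y] (𝒯 : Set (X →L[ℂ] Y)) : Prop :=
  ∃ C : ℝ, 0 ≤ C ∧ ∀ (N : ℕ) (T : Fin N → X →L[ℂ] Y) (x : Fin N → X), (∀ n, T n ∈ 𝒯) →
    rademacherNorm (fun n => T n (x n)) ≤ C * rademacherNorm x

end WeylHS

end

noncomputable section

/-! Multiplication by exp(-φ/p) carries L^p(μ) isometrically onto L^p(dx) and respects square
functions, so the operators may be studied after this conjugation. The kernel of `kernelAction` then
acquires the factor exp((1/2 - 1/p)(φ(y) - φ(x))), and the growth condition says exactly that the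
decay exp(-|M·k|) of the symbol compensates it up to exp(ε) (`enorm_weylKernel_mul_weight_le`). What
is left is dominated by exp(ε) c^{-d} |G((x-y)/c)|, together with multiplication by a bounded
function.

A kernel with an integrable radially decreasing majorant lies below a superposition of indicators of
balls with controlled total mass. Adding κ times the identity gives a positive symmetric operator S
with (Su)² ≤ L S(u²) and Su ≤ L(Mu + u), where M now denotes the Hardy–Littlewood maximal operator;
the constant L is the same for the whole family (`exists_isWeylMajorant`).

Such operators satisfy a uniform square function estimate on L^p
(`MaximallyDominated.exists_squareFunction_le`). For p > 2 one tests ∑ (Sₙuₙ)² against a weight w;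
symmetry moves Sₙ onto w, where it is replaced by Mw + w, which no longer depends on n. The case p <
2 is dual to this, and p = 2 is the same argument with w = 1. By Khintchine's inequality and
orthogonality of signs, square functions are comparable to Rademacher averages in L^p, and
R-boundedness follows (`rBounded_of_squareIntegral_le`).

The same majorants make the integrals converge absolutely and give bounded extensions. These are
unique because the core is dense and because the splitting of a symbol is unique: a nonzero multiple
of the Dirac mass, the Fourier transform of a constant, is not an integrable function
(`decomposition_unique`). -/

namespace WeylHS

/-! ### The Hardy–Littlewood maximal function -/

section Maximal

variable {V : Type*} [NormedAddCommGroup V] [MeasurableSpace V] (μ : Measure V)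

/-- The centred Hardy–Littlewood maximal function of a nonnegative function. -/
def maximalFn (u : V → ℝ≥0∞) (y : V) : ℝ≥0∞ :=
  ⨆ (r : ℝ) (_ : 0 < r), (μ (Metric.ball 0 r))⁻¹ * ∫⁻ x in Metric.ball y r, u x ∂μ

variable {μ}

theorem average_le_maximalFn (u : V → ℝ≥0∞) (y : V) {r : ℝ} (hr : 0 < r) :
    (μ (Metric.ball 0 r))⁻¹ * ∫⁻ x in Metric.ball y r, u x ∂μ ≤ maximalFn μ u y :=
  le_iSup₂_of_le r hr le_rfl

theorem maximalFn_mono {u w : V → ℝ≥0∞} (h : u ≤ w) : maximalFn μ u ≤ maximalFn μ w := by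
  intro y
  refine iSup₂_mono fun r _ => ?_
  gcongr
  exact h _

/-- An open ball is the increasing union of smaller concentric balls, and each of these remains
inside the balls of the original radius about nearby centres. No measurability of `u` is needed. -/
theorem lowerSemicontinuous_setLIntegral_ball (u : V → ℝ≥0∞) (r : ℝ) :
    LowerSemicontinuous fun y => ∫⁻ x in Metric.ball y r, u x ∂μ := by
  intro y t ht
  have hun : Metric.ball y r = ⋃ n : ℕ, Metric.ball y (r - 1 / ((n : ℝ) + 1)) := by
    ext z
    simp only [Metric.mem_ball, Set.mem_iUnion]
    constructor
    · intro hz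
      obtain ⟨n, hn⟩ := exists_nat_one_div_lt (sub_pos.2 hz)
      exact ⟨n, by linarith⟩
    · rintro ⟨n, hn⟩
      have : 0 < 1 / ((n : ℝ) + 1) := by positivity
      linarith
  have hdir : Directed (· ⊆ ·) fun n : ℕ => Metric.ball y (r - 1 / ((n : ℝ) + 1)) := by
    refine Monotone.directed_le (f := fun n : ℕ => Metric.ball y (r - 1 / ((n : ℝ) + 1))) ?_
    intro m n hmn
    refine Metric.ball_subset_ball ?_
    have : 1 / ((n : ℝ) + 1) ≤ 1 / ((m : ℝ) + 1) :=
      one_div_le_one_div_of_le (by positivity) (by gcongr)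
    linarith
  replace ht : t < ∫⁻ x in Metric.ball y r, u x ∂μ := ht
  rw [hun, setLIntegral_iUnion_of_directed _ hdir, lt_iSup_iff] at ht
  obtain ⟨n, hn⟩ := ht
  filter_upwards [Metric.ball_mem_nhds y (show 0 < 1 / ((n : ℝ) + 1) by positivity)] with y' hy'
  refine hn.trans_le (lintegral_mono_set ?_)
  refine Metric.ball_subset_ball' ?_
  rw [Metric.mem_ball, dist_comm] at hy'
  linarith

theorem lowerSemicontinuous_maximalFn (u : V → ℝ≥0∞) : LowerSemicontinuous (maximalFn μ u) := by
  refine lowerSemicontinuous_iSup fun r => lowerSemicontinuous_iSup fun _ => ?_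
  intro y t ht
  by_cases h0 : (μ (Metric.ball (0 : V) r))⁻¹ = 0
  · simp [h0] at ht
  by_cases h1 : (μ (Metric.ball (0 : V) r))⁻¹ = ⊤
  -- Here the reference ball is null, so the quotient is infinite as soon as the integral is
  -- positive.
  · rw [h1] at ht
    have h2 : (0 : ℝ≥0∞) < ∫⁻ x in Metric.ball y r, u x ∂μ := by
      rcases eq_or_ne (∫⁻ x in Metric.ball y r, u x ∂μ) 0 with h | h
      · simp [h] at ht
      · exact pos_iff_ne_zero.2 h
    filter_upwards [lowerSemicontinuous_setLIntegral_ball (μ := μ) u r y 0 h2] with z hz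
    rw [h1, ENNReal.top_mul hz.ne']
    exact ht.trans_le le_top
  · have h2 : t / (μ (Metric.ball (0 : V) r))⁻¹ < ∫⁻ x in Metric.ball y r, u x ∂μ := by
      rw [ENNReal.div_lt_iff (Or.inl h0) (Or.inl h1), mul_comm]
      exact ht
    filter_upwards [lowerSemicontinuous_setLIntegral_ball (μ := μ) u r y _ h2] with z hz
    rw [gt_iff_lt, ENNReal.div_lt_iff (Or.inl h0) (Or.inl h1), mul_comm] at hz
    exact hz

variable [BorelSpace V]

theorem measurable_maximalFn (u : V → ℝ≥0∞) : Measurable (maximalFn μ u) :=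
  (lowerSemicontinuous_maximalFn u).measurable

variable [NormedSpace ℝ V] [FiniteDimensional ℝ V] [μ.IsAddHaarMeasure]

/-- The average of a constant is that constant. This removes the bounded part of a function in the
truncation argument for the strong type inequality. -/
theorem maximalFn_add_const_le (u : V → ℝ≥0∞) (s : ℝ≥0∞) (y : V) :
    maximalFn μ (fun x => u x + s) y ≤ maximalFn μ u y + s := by
  refine iSup₂_le fun r hr => ?_
  rw [lintegral_add_right _ measurable_const, setLIntegral_const, mul_add]
  refine add_le_add (average_le_maximalFn u y hr) ?_
  rw [Measure.addHaar_ball_center μ y, mul_comm s, ← mul_assoc,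
    ENNReal.inv_mul_cancel (Metric.measure_ball_pos μ 0 hr).ne' measure_ball_lt_top.ne, one_mul]

variable [Nontrivial V]

/-- The weak type `(1,1)` inequality. -/
theorem measure_lt_maximalFn_le (u : V → ℝ≥0∞) {t : ℝ≥0∞} (ht : t ≠ 0) (ht' : t ≠ ⊤) :
    t * μ {y | t < maximalFn μ u y} ≤ 5 ^ Module.finrank ℝ V * ∫⁻ x, u x ∂μ := by
  classical
  set n := Module.finrank ℝ V
  have hn : n ≠ 0 := Module.finrank_pos.ne'
  by_cases hI : ∫⁻ x, u x ∂μ = ⊤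
  · rw [hI, ENNReal.mul_top (by positivity)]
    exact le_top
  set S := {y | t < maximalFn μ u y}
  have hex : ∀ y ∈ S, ∃ r : ℝ, 0 < r ∧
      t * μ (Metric.ball y r) ≤ ∫⁻ x in Metric.ball y r, u x ∂μ := by
    intro y hy
    simp only [S, Set.mem_ofPred_eq, maximalFn, lt_iSup_iff] at hy
    obtain ⟨r, hr, h⟩ := hy
    refine ⟨r, hr, ?_⟩
    rw [mul_comm, ← div_eq_mul_inv, ENNReal.lt_div_iff_mul_lt
      (Or.inl (Metric.measure_ball_pos μ 0 hr).ne') (Or.inl measure_ball_lt_top.ne)] at h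
    rw [Measure.addHaar_ball_center]
    exact h.le
  choose! r hr hball using hex
  set I := ∫⁻ x, u x ∂μ
  have hb1 : μ (Metric.ball (0 : V) 1) ≠ 0 := (Metric.measure_ball_pos μ 0 one_pos).ne'
  have hb1' : μ (Metric.ball (0 : V) 1) ≠ ⊤ := measure_ball_lt_top.ne
  have hbd : ∃ R : ℝ, ∀ y ∈ S, r y ≤ R := by
    set Q := I / (t * μ (Metric.ball (0 : V) 1))
    have hQ : Q ≠ ⊤ := ENNReal.div_ne_top hI (mul_ne_zero ht hb1)
    -- The volume bound controls `r y ^ n`; returning to `r y` uses r ≤ r ^ n, valid for r ≥ 1.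
    refine ⟨max 1 Q.toReal, fun y hy => ?_⟩
    by_contra! hlt
    obtain ⟨h1, h2⟩ := max_lt_iff.1 hlt
    have h3 := (hball y hy).trans (setLIntegral_le_lintegral _ _)
    rw [Measure.addHaar_ball μ y (hr y hy).le, mul_left_comm] at h3
    have h4 : ENNReal.ofReal (r y ^ n) ≤ Q := by
      rw [ENNReal.le_div_iff_mul_le (Or.inl (mul_ne_zero ht hb1))
        (Or.inl (ENNReal.mul_ne_top ht' hb1'))]
      exact h3
    have h5 := ENNReal.toReal_mono hQ h4
    rw [ENNReal.toReal_ofReal (by positivity [hr y hy])] at h5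
    have h6 : r y ≤ r y ^ n := le_self_pow₀ h1.le hn
    linarith
  obtain ⟨R, hR⟩ := hbd
  -- Vitali: disjoint selected balls whose fivefold enlargements cover `S`. This is the source of
  -- the constant 5 ^ n.
  obtain ⟨v, hvS, hdisj, hcov⟩ := Vitali.exists_disjoint_subfamily_covering_enlargement_closedBall
    S (fun y => y) r R hR 5 (by norm_num)
  have hcount : v.Countable := hdisj.countable_of_nonempty_interior fun y hy => by
    refine ⟨y, ?_⟩
    rw [interior_closedBall _ (hr y (hvS hy)).ne']
    exact Metric.mem_ball_self (hr y (hvS hy))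
  have hsub : S ⊆ ⋃ y ∈ v, Metric.closedBall y (5 * r y) := by
    intro y hy
    obtain ⟨b, hb, h⟩ := hcov y hy
    exact Set.mem_biUnion hb (h (Metric.mem_closedBall_self (hr y hy).le))
  have hone : ∀ y ∈ v, t * μ (Metric.closedBall y (5 * r y)) ≤
      5 ^ n * ∫⁻ x in Metric.closedBall y (r y), u x ∂μ := by
    intro y hy
    have hy' := hvS hy
    have h5 : ENNReal.ofReal ((5 : ℝ) ^ n) = 5 ^ n := by
      rw [ENNReal.ofReal_pow (by norm_num)]; norm_num
    calc t * μ (Metric.closedBall y (5 * r y))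
        = 5 ^ n * (t * μ (Metric.ball y (r y))) := by
          rw [Measure.addHaar_closedBall_eq_addHaar_ball, Measure.addHaar_ball_mul_of_pos _ _
            (by norm_num), h5, Measure.addHaar_ball_center μ y (r y)]
          ring
      _ ≤ _ := by
          gcongr
          exact (hball y hy').trans (lintegral_mono_set Metric.ball_subset_closedBall)
  calc t * μ S ≤ t * ∑' y : v, μ (Metric.closedBall (y : V) (5 * r y)) := by
        gcongr
        exact (measure_mono hsub).trans (measure_biUnion_le μ hcount _)
    _ = ∑' y : v, t * μ (Metric.closedBall (y : V) (5 * r y)) := ENNReal.tsum_mul_left.symm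
    _ ≤ ∑' y : v, 5 ^ n * ∫⁻ x in Metric.closedBall (y : V) (r y), u x ∂μ :=
        ENNReal.tsum_le_tsum fun y => hone y y.2
    _ = 5 ^ n * ∫⁻ x in ⋃ y ∈ v, Metric.closedBall (y : V) (r y), u x ∂μ := by
        rw [ENNReal.tsum_mul_left, lintegral_biUnion hcount
          (fun _ _ => Metric.isClosed_closedBall.measurableSet) hdisj]
    _ ≤ 5 ^ n * ∫⁻ x, u x ∂μ := by
        gcongr
        exact Measure.restrict_le_self

end Maximal

/-! ### The layer cake formula -/

section LayerCake

/-- `∫₀^a t^{r-1} dt = a^r / r` for extended nonnegative `a`. -/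
theorem lintegral_rpow_indicator_lt {r : ℝ} (hr : 0 < r) (a : ℝ≥0∞) :
    ∫⁻ t in Set.Ioi (0 : ℝ), (if ENNReal.ofReal t < a then ENNReal.ofReal (t ^ (r - 1)) else 0) =
      a ^ r / ENNReal.ofReal r := by
  have key : ∀ b : ℝ, 0 ≤ b →
      ∫⁻ t in Set.Ioi (0 : ℝ),
        (if t < b then ENNReal.ofReal (t ^ (r - 1)) else 0) =
        ENNReal.ofReal (b ^ r / r) := by
    intro b hb
    have h1 : ∀ t : ℝ, (if t < b then ENNReal.ofReal (t ^ (r - 1)) else 0) =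
        (Set.Iio b).indicator (fun t : ℝ => ENNReal.ofReal (t ^ (r - 1))) t := by
      intro t; simp [Set.indicator]
    simp_rw [h1]
    rw [lintegral_indicator measurableSet_Iio, Measure.restrict_restrict measurableSet_Iio,
      Set.inter_comm, Set.Ioi_inter_Iio, ← setLIntegral_congr Ioo_ae_eq_Ioc.symm]
    have hint : IntervalIntegrable (fun t : ℝ => t ^ (r - 1)) volume 0 b :=
      intervalIntegral.intervalIntegrable_rpow' (by linarith)
    rw [← ofReal_integral_eq_lintegral_ofReal, ← intervalIntegral.integral_of_le hb,
      integral_rpow (Or.inl (by linarith))]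
    · simp [Real.zero_rpow hr.ne']
    · exact (intervalIntegrable_iff_integrableOn_Ioc_of_le hb).1 hint
    · filter_upwards [self_mem_ae_restrict measurableSet_Ioc] with t ht
      exact Real.rpow_nonneg ht.1.le _
  rcases eq_or_ne a ⊤ with rfl | ha
  · rw [ENNReal.top_rpow_of_pos hr, ENNReal.top_div_of_ne_top ENNReal.ofReal_ne_top]
    simp only [ENNReal.ofReal_lt_top, if_true]
    refine ENNReal.eq_top_of_forall_nnreal_le fun b => ?_
    -- With this cut-off the truncated integral equals `b`, so the full integral exceeds every
    -- finite bound.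
    have := key ((r * b) ^ (1 / r)) (by positivity)
    rw [← Real.rpow_mul (by positivity), one_div_mul_cancel hr.ne', Real.rpow_one,
      mul_div_cancel_left₀ _ hr.ne', ENNReal.ofReal_coe_nnreal] at this
    rw [← this]
    refine lintegral_mono fun t => ?_
    split_ifs <;> simp
  · have := key a.toReal ENNReal.toReal_nonneg
    rw [ENNReal.ofReal_div_of_pos hr, ← ENNReal.ofReal_rpow_of_nonneg ENNReal.toReal_nonneg hr.le,
      ENNReal.ofReal_toReal ha] at this
    rw [← this]
    refine setLIntegral_congr_fun measurableSet_Ioi fun t ht => ?_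
    simp only [ENNReal.ofReal_lt_iff_lt_toReal (le_of_lt ht) ha]

/-- The layer cake formula for extended nonnegative functions. -/
theorem lintegral_rpow_eq_lintegral_measure_lt {α : Type*} [MeasurableSpace α] {μ : Measure α}
    [SFinite μ] {f : α → ℝ≥0∞} (hf : Measurable f) (w : α → ℝ≥0∞) (hw : Measurable w)
    {r : ℝ} (hr : 0 < r) :
    ∫⁻ x, w x * f x ^ r ∂μ = ENNReal.ofReal r * ∫⁻ t in Set.Ioi (0 : ℝ),
      ENNReal.ofReal (t ^ (r - 1)) * ∫⁻ x, {x | ENNReal.ofReal t < f x}.indicator w x ∂μ := by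
  have hr0 : ENNReal.ofReal r ≠ 0 := by simpa using hr
  have hm : ∀ t : ℝ, MeasurableSet {x | ENNReal.ofReal t < f x} := fun t =>
    measurableSet_lt measurable_const hf
  have hmeas : Measurable (Function.uncurry fun (x : α) (t : ℝ) => w x *
      (if ENNReal.ofReal t < f x then ENNReal.ofReal (t ^ (r - 1)) else 0)) := by
    refine (hw.comp measurable_fst).mul (Measurable.ite ?_ ?_ measurable_const)
    · exact measurableSet_lt (ENNReal.measurable_ofReal.comp measurable_snd)
        (hf.comp measurable_fst)
    · fun_prop
  calc ∫⁻ x, w x * f x ^ r ∂μ = ENNReal.ofReal r * ∫⁻ x, (∫⁻ t in Set.Ioi (0 : ℝ), w x *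
        (if ENNReal.ofReal t < f x then ENNReal.ofReal (t ^ (r - 1)) else 0)) ∂μ := by
        rw [← lintegral_const_mul' _ _ ENNReal.ofReal_ne_top]
        refine lintegral_congr fun x => ?_
        rw [lintegral_const_mul _ (Measurable.ite (measurableSet_lt ENNReal.measurable_ofReal
          measurable_const) (by fun_prop) measurable_const), lintegral_rpow_indicator_lt hr,
          mul_left_comm, ENNReal.mul_div_cancel hr0 ENNReal.ofReal_ne_top]
    _ = _ := by
        rw [lintegral_lintegral_swap (f := fun (x : α) (t : ℝ) => w x *
          (if ENNReal.ofReal t < f x then ENNReal.ofReal (t ^ (r - 1)) else 0)) hmeas.aemeasurable]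
        congr 1
        refine lintegral_congr fun t => ?_
        rw [← lintegral_const_mul _ (hw.indicator (hm t))]
        refine lintegral_congr fun x => ?_
        by_cases h : ENNReal.ofReal t < f x <;> simp [Set.indicator, h, mul_comm]

end LayerCake

/-! ### The strong type inequality by truncation -/

section StrongType

variable {V : Type*} [NormedAddCommGroup V] [NormedSpace ℝ V] [FiniteDimensional ℝ V]
  [MeasurableSpace V] [BorelSpace V] [Nontrivial V] {μ : Measure V} [μ.IsAddHaarMeasure]

/-- The strong type `(q,q)` inequality for `1 < q < ∞`. -/
theorem lintegral_maximalFn_rpow_le {q : ℝ} (hq : 1 < q) :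
    ∃ C : ℝ≥0∞, C ≠ ⊤ ∧ ∀ u : V → ℝ≥0∞, Measurable u →
      ∫⁻ y, maximalFn μ u y ^ q ∂μ ≤ C * ∫⁻ x, u x ^ q ∂μ := by
  set n := Module.finrank ℝ V
  refine ⟨ENNReal.ofReal q * (2 * 5 ^ n) * (2 ^ (q - 1) / ENNReal.ofReal (q - 1)),
    ?_, fun u hu => ?_⟩
  · refine ENNReal.mul_ne_top (ENNReal.mul_ne_top ENNReal.ofReal_ne_top (by finiteness)) ?_
    refine ENNReal.div_ne_top (ENNReal.rpow_ne_top_of_nonneg (by linarith) (by simp)) ?_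
    simpa using hq
  -- Marcinkiewicz truncation: the part of `u` below t/2 contributes at most t/2 to the maximal
  -- function, so the weak type bound at height t/2 is applied only to the part where 2u > t.
  have hweak : ∀ t : ℝ, 0 < t → μ {y | ENNReal.ofReal t < maximalFn μ u y} ≤
      ENNReal.ofReal (t⁻¹) * (2 * 5 ^ n) *
        ∫⁻ x, {x | ENNReal.ofReal t < 2 * u x}.indicator u x ∂μ := by
    intro t ht
    set s : ℝ≥0∞ := ENNReal.ofReal (t / 2)
    have hs0 : s ≠ 0 := by simpa [s] using ht
    have hs1 : s ≠ ⊤ := ENNReal.ofReal_ne_top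
    have h2s : ENNReal.ofReal t = s + s := by
      rw [← ENNReal.ofReal_add (by positivity) (by positivity)]; congr 1; ring
    set w := {x | ENNReal.ofReal t < 2 * u x}.indicator u
    have hle : u ≤ fun x => w x + s := by
      intro x
      by_cases hx : ENNReal.ofReal t < 2 * u x
      · simp [w, hx]
      · simp only [w, Set.indicator, Set.mem_ofPred_eq, hx, if_false, zero_add]
        rw [not_lt, h2s, two_mul] at hx
        by_contra! hlt
        exact absurd hx (not_le.2 (ENNReal.add_lt_add hlt hlt))
    have hsub : {y | ENNReal.ofReal t < maximalFn μ u y} ⊆ {y | s < maximalFn μ w y} := by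
      intro y hy
      have h1 : s + s < maximalFn μ w y + s := by
        rw [← h2s]
        exact lt_of_lt_of_le hy ((maximalFn_mono hle y).trans (maximalFn_add_const_le w s y))
      exact lt_of_add_lt_add_right h1
    have h3 := measure_lt_maximalFn_le (μ := μ) w hs0 hs1
    have hts : ENNReal.ofReal t⁻¹ * 2 * s = 1 := by
      have : (2 : ℝ≥0∞) = ENNReal.ofReal 2 := by simp
      rw [this, ← ENNReal.ofReal_mul (by positivity), ← ENNReal.ofReal_mul (by positivity)]
      rw [show t⁻¹ * 2 * (t / 2) = 1 by field_simp, ENNReal.ofReal_one]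
    calc μ {y | ENNReal.ofReal t < maximalFn μ u y} ≤ μ {y | s < maximalFn μ w y} :=
          measure_mono hsub
      _ = ENNReal.ofReal t⁻¹ * 2 * (s * μ {y | s < maximalFn μ w y}) := by
          rw [← mul_assoc, hts, one_mul]
      _ ≤ ENNReal.ofReal t⁻¹ * 2 * (5 ^ n * ∫⁻ x, w x ∂μ) := by gcongr
      _ = _ := by ring
  have hlc := lintegral_rpow_eq_lintegral_measure_lt (μ := μ) (measurable_maximalFn (μ := μ) u)
    (fun _ => 1) measurable_const (show 0 < q by linarith)
  simp only [one_mul] at hlc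
  -- The factor t⁻¹ of the weak estimate lowers the exponent by one; the truncated masses are
  -- therefore summed by the layer cake formula for 2u with exponent q - 1 and weight `u`.
  have hlc2 := lintegral_rpow_eq_lintegral_measure_lt (μ := μ) (hu.const_mul 2) u hu
    (show 0 < q - 1 by linarith)
  have hq1 : ENNReal.ofReal (q - 1) ≠ 0 := by simpa using hq
  rw [hlc]
  calc ENNReal.ofReal q * ∫⁻ t in Set.Ioi (0 : ℝ), ENNReal.ofReal (t ^ (q - 1)) *
        ∫⁻ x, {x | ENNReal.ofReal t < maximalFn μ u x}.indicator (fun _ => 1) x ∂μ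
      ≤ ENNReal.ofReal q * ∫⁻ t in Set.Ioi (0 : ℝ), (2 * 5 ^ n) *
        (ENNReal.ofReal (t ^ (q - 1 - 1)) *
        ∫⁻ x, {x | ENNReal.ofReal t < 2 * u x}.indicator u x ∂μ) := by
        gcongr ENNReal.ofReal q * ?_
        refine setLIntegral_mono' measurableSet_Ioi fun t ht => ?_
        have ht' : (0 : ℝ) < t := ht
        rw [lintegral_indicator_const (measurableSet_lt measurable_const (measurable_maximalFn u)),
          one_mul, Real.rpow_sub_one ht'.ne' (q - 1), div_eq_mul_inv, ENNReal.ofReal_mul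
          (Real.rpow_nonneg ht'.le _)]
        calc _ ≤ ENNReal.ofReal (t ^ (q - 1)) * (ENNReal.ofReal (t⁻¹) * (2 * 5 ^ n) *
            ∫⁻ x, {x | ENNReal.ofReal t < 2 * u x}.indicator u x ∂μ) := by
              gcongr; exact hweak t ht'
          _ = _ := by ring
    _ = ENNReal.ofReal q * (2 * 5 ^ n) * ((ENNReal.ofReal (q - 1))⁻¹ *
          ∫⁻ x, u x * (2 * u x) ^ (q - 1) ∂μ) := by
        rw [lintegral_const_mul' _ _ (by finiteness), hlc2, ← mul_assoc,
          ← mul_assoc _ (ENNReal.ofReal (q - 1)),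
          ENNReal.inv_mul_cancel hq1 ENNReal.ofReal_ne_top, one_mul]
    _ = _ := by
        have : ∀ x, u x * (2 * u x) ^ (q - 1) = 2 ^ (q - 1) * u x ^ q := by
          intro x
          rw [ENNReal.mul_rpow_of_nonneg _ _ (by linarith), mul_left_comm]
          congr 1
          conv_rhs => rw [show q = 1 + (q - 1) by ring,
            ENNReal.rpow_add_of_nonneg _ _ zero_le_one (by linarith), ENNReal.rpow_one]
        simp_rw [this]
        rw [lintegral_const_mul' _ _ (ENNReal.rpow_ne_top_of_nonneg (by linarith) (by simp))]
        rw [div_eq_mul_inv]; ring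

end StrongType

/-! ### Positive symmetric operators dominated by the maximal function -/

section Dominated

variable {V : Type*} [NormedAddCommGroup V] [MeasurableSpace V]

/-- A positive symmetric operator on nonnegative functions that satisfies a Cauchy–Schwarz
inequality and is dominated by the maximal function, with constant `L`. -/
structure MaximallyDominated (μ : Measure V) (L : ℝ≥0) (S : (V → ℝ≥0∞) → V → ℝ≥0∞) : Prop where
  measurable : ∀ u, Measurable u → Measurable (S u)
  symm : ∀ u w, Measurable u → Measurable w → ∫⁻ y, S u y * w y ∂μ = ∫⁻ y, u y * S w y ∂μ
  sq_le : ∀ u, Measurable u → ∀ y, S u y ^ 2 ≤ L * S (fun x => u x ^ 2) y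
  le_maximalFn : ∀ u, Measurable u → ∀ y, S u y ≤ L * (maximalFn μ u y + u y)

variable {μ : Measure V}

/-- Absorption of the right-hand power of `X`. Dividing by it requires `X` to be finite beforehand,
which is why qualitative finiteness is established before each quantitative estimate. -/
theorem le_rpow_of_le_mul_rpow {X A : ℝ≥0∞} (hX : X ≠ ⊤) {s t : ℝ} (hst : s.HolderConjugate t)
    (h : X ≤ A * X ^ (1 / t)) : X ≤ A ^ s := by
  rcases eq_or_ne X 0 with rfl | h0
  · exact zero_le
  have hs := hst.pos
  have ht := hst.symm.pos
  have h1 : X = X ^ (1 / s) * X ^ (1 / t) := by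
    rw [← ENNReal.rpow_add _ _ h0 hX, one_div, one_div, hst.inv_add_inv_eq_one, ENNReal.rpow_one]
  have h2 : X ^ (1 / s) ≤ A := by
    have h3 : X ^ (1 / t) ≠ 0 := by simp [ENNReal.rpow_eq_zero_iff, h0, hX]
    have h4 : X ^ (1 / t) ≠ ⊤ := ENNReal.rpow_ne_top_of_nonneg (by positivity) hX
    by_contra! hlt
    have := (ENNReal.mul_lt_mul_iff_left h3 h4).2 hlt
    rw [← h1] at this
    exact absurd h (not_le.2 this)
  calc X = (X ^ (1 / s)) ^ s := by
        rw [← ENNReal.rpow_mul, one_div_mul_cancel hs.ne', ENNReal.rpow_one]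
    _ ≤ A ^ s := by gcongr

/-- The ℓ² norm is at most the ℓ¹ norm, followed by convexity. The dependence on `N` is harmless,
since the bound serves only to prove finiteness. -/
theorem rpow_half_sum_sq_le {N : ℕ} (a : Fin N → ℝ≥0∞) {p : ℝ} (hp : 1 ≤ p) :
    (∑ n, a n ^ 2) ^ (p / 2) ≤ (N : ℝ≥0∞) ^ (p - 1) * ∑ n, a n ^ p := by
  have h1 : ∑ n, a n ^ 2 ≤ (∑ n, a n) ^ 2 := by
    rw [sq, Finset.sum_mul]
    refine Finset.sum_le_sum fun n _ => ?_
    rw [sq]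
    gcongr
    exact Finset.single_le_sum (fun _ _ => zero_le) (Finset.mem_univ n)
  calc (∑ n, a n ^ 2) ^ (p / 2) ≤ ((∑ n, a n) ^ 2) ^ (p / 2) := by gcongr
    _ = (∑ n, a n) ^ p := by
        rw [← ENNReal.rpow_natCast, ← ENNReal.rpow_mul]; congr 1; push_cast; ring
    _ ≤ _ := by simpa using ENNReal.rpow_sum_le_const_mul_sum_rpow Finset.univ a hp

variable [NormedSpace ℝ V] [FiniteDimensional ℝ V] [BorelSpace V] [μ.IsAddHaarMeasure]

theorem maximalFn_one_le (y : V) : maximalFn μ (fun _ => 1) y ≤ 1 := by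
  have := maximalFn_add_const_le (μ := μ) (fun _ => 0) 1 y
  simp only [zero_add] at this
  refine this.trans ?_
  simp [maximalFn]


/-- The square function estimate for `p = 2`. -/
theorem MaximallyDominated.lintegral_sq_le {L : ℝ≥0} {S : (V → ℝ≥0∞) → V → ℝ≥0∞}
    (hS : MaximallyDominated μ L S) {u : V → ℝ≥0∞} (hu : Measurable u) :
    ∫⁻ y, S u y ^ 2 ∂μ ≤ 2 * L ^ 2 * ∫⁻ y, u y ^ 2 ∂μ := by
  have hu2 : Measurable fun y => u y ^ 2 := hu.pow_const 2
  calc ∫⁻ y, S u y ^ 2 ∂μ ≤ ∫⁻ y, L * (S (fun x => u x ^ 2) y * 1) ∂μ :=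
        lintegral_mono fun y => by simpa using hS.sq_le u hu y
    -- Symmetry moves `S` onto the constant function, where it is at most 2L.
    _ = L * ∫⁻ y, u y ^ 2 * S (fun _ => 1) y ∂μ := by
        rw [lintegral_const_mul' _ _ (by simp), hS.symm _ (fun _ => 1) hu2 measurable_const]
    _ ≤ L * ∫⁻ y, u y ^ 2 * (L * 2) ∂μ := by
        gcongr with y
        refine (hS.le_maximalFn _ measurable_const y).trans ?_
        gcongr
        rw [← one_add_one_eq_two]
        gcongr
        exact maximalFn_one_le y
    _ = _ := by rw [lintegral_mul_const' _ _ (by finiteness)]; ring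

variable [Nontrivial V]

/-- The strong type inequality for the operator `u ↦ Mu + u`. -/
theorem lintegral_maximalFn_add_rpow_le (μ : Measure V) [μ.IsAddHaarMeasure] {q : ℝ} (hq : 1 < q) :
    ∃ C : ℝ≥0∞, C ≠ ⊤ ∧ ∀ u : V → ℝ≥0∞, Measurable u →
      ∫⁻ y, (maximalFn μ u y + u y) ^ q ∂μ ≤ C * ∫⁻ x, u x ^ q ∂μ := by
  obtain ⟨C, hC, h⟩ := lintegral_maximalFn_rpow_le (V := V) (μ := μ) hq
  have h2 : (2 : ℝ≥0∞) ^ (q - 1) ≠ ⊤ := ENNReal.rpow_ne_top_of_nonneg (by linarith) (by simp)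
  refine ⟨2 ^ (q - 1) * (C + 1), ENNReal.mul_ne_top h2 (by finiteness), fun u hu => ?_⟩
  calc ∫⁻ y, (maximalFn μ u y + u y) ^ q ∂μ
      ≤ ∫⁻ y, 2 ^ (q - 1) * (maximalFn μ u y ^ q + u y ^ q) ∂μ :=
        lintegral_mono fun y => ENNReal.rpow_add_le_mul_rpow_add_rpow _ _ hq.le
    _ = 2 ^ (q - 1) * (∫⁻ y, maximalFn μ u y ^ q ∂μ + ∫⁻ y, u y ^ q ∂μ) := by
        rw [lintegral_const_mul' _ _ h2, lintegral_add_right _ (by fun_prop)]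
    _ ≤ 2 ^ (q - 1) * (C * ∫⁻ y, u y ^ q ∂μ + ∫⁻ y, u y ^ q ∂μ) := by gcongr; exact h u hu
    _ = _ := by ring

/-- Operators dominated by the maximal function are uniformly bounded on `L^q`. -/
theorem MaximallyDominated.exists_lintegral_rpow_le (μ : Measure V) [μ.IsAddHaarMeasure] (L : ℝ≥0)
    {q : ℝ} (hq : 1 < q) :
    ∃ C : ℝ≥0∞, C ≠ ⊤ ∧ ∀ S, MaximallyDominated μ L S → ∀ u : V → ℝ≥0∞, Measurable u →
      ∫⁻ y, S u y ^ q ∂μ ≤ C * ∫⁻ x, u x ^ q ∂μ := by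
  obtain ⟨C, hC, h⟩ := lintegral_maximalFn_add_rpow_le μ hq
  have h2 : (L : ℝ≥0∞) ^ q ≠ ⊤ := ENNReal.rpow_ne_top_of_nonneg (by linarith) (by simp)
  refine ⟨L ^ q * C, ENNReal.mul_ne_top h2 hC, fun S hS u hu => ?_⟩
  calc ∫⁻ y, S u y ^ q ∂μ ≤ ∫⁻ y, L ^ q * (maximalFn μ u y + u y) ^ q ∂μ := by
        refine lintegral_mono fun y => ?_
        rw [← ENNReal.mul_rpow_of_nonneg _ _ (by linarith)]
        gcongr
        exact hS.le_maximalFn u hu y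
    _ = L ^ q * ∫⁻ y, (maximalFn μ u y + u y) ^ q ∂μ := lintegral_const_mul' _ _ h2
    _ ≤ L ^ q * (C * ∫⁻ y, u y ^ q ∂μ) := by gcongr; exact h u hu
    _ = _ := by ring

/-- A priori finiteness, with a bound depending on `N`; it licenses the absorption in the uniform
estimates. -/
theorem MaximallyDominated.lintegral_sum_sq_ne_top {L : ℝ≥0} {p : ℝ} (hp : 1 < p) {N : ℕ}
    {S : Fin N → (V → ℝ≥0∞) → V → ℝ≥0∞} (hS : ∀ n, MaximallyDominated μ L (S n))
    {u : Fin N → V → ℝ≥0∞} (hu : ∀ n, Measurable (u n)) (hfin : ∀ n, ∫⁻ x, u n x ^ p ∂μ ≠ ⊤) :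
    ∫⁻ y, (∑ n, S n (u n) y ^ 2) ^ (p / 2) ∂μ ≠ ⊤ := by
  obtain ⟨C, hC, h⟩ := MaximallyDominated.exists_lintegral_rpow_le μ L hp
  refine ne_top_of_le_ne_top ?_ (lintegral_mono fun y => rpow_half_sum_sq_le _ hp.le)
  have h2 : (N : ℝ≥0∞) ^ (p - 1) ≠ ⊤ := ENNReal.rpow_ne_top_of_nonneg (by linarith) (by simp)
  rw [lintegral_const_mul' _ _ h2,
    lintegral_finsetSum _ fun n _ => ((hS n).measurable _ (hu n)).pow_const p]
  refine ENNReal.mul_ne_top h2 (ENNReal.sum_ne_top.2 fun n _ => ?_)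
  exact ne_top_of_le_ne_top (ENNReal.mul_ne_top hC (hfin n)) (h _ (hS n) _ (hu n))

/-- The square function estimate for `p > 2`. -/
theorem MaximallyDominated.exists_squareFunction_le_of_two_lt (μ : Measure V) [μ.IsAddHaarMeasure]
    (L : ℝ≥0) {p : ℝ} (hp : 2 < p) :
    ∃ C : ℝ≥0∞, C ≠ ⊤ ∧ ∀ (N : ℕ) (S : Fin N → (V → ℝ≥0∞) → V → ℝ≥0∞)
      (u : Fin N → V → ℝ≥0∞), (∀ n, MaximallyDominated μ L (S n)) → (∀ n, Measurable (u n)) →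
      (∀ n, ∫⁻ x, u n x ^ p ∂μ ≠ ⊤) →
      ∫⁻ y, (∑ n, S n (u n) y ^ 2) ^ (p / 2) ∂μ ≤ C * ∫⁻ y, (∑ n, u n y ^ 2) ^ (p / 2) ∂μ := by
  set s := p / 2
  have hs1 : 1 < s := by simp only [s]; linarith
  have hst := Real.HolderConjugate.conjExponent hs1
  set t := s.conjExponent
  obtain ⟨C, hC, hM⟩ := lintegral_maximalFn_add_rpow_le μ hst.symm.lt
  refine ⟨(L ^ 2 * C ^ (1 / t)) ^ s, ENNReal.rpow_ne_top_of_nonneg hst.nonneg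
    (ENNReal.mul_ne_top (by finiteness) (ENNReal.rpow_ne_top_of_nonneg
      (by have := hst.symm.pos; positivity) hC)), fun N S u hS hu hfin => ?_⟩
  set F := fun y => ∑ n, S n (u n) y ^ 2
  set U := fun y => ∑ n, u n y ^ 2
  have hSu : ∀ n, Measurable (S n (u n)) := fun n => (hS n).measurable _ (hu n)
  have hF : Measurable F := Finset.measurable_fun_sum _ fun n _ => (hSu n).pow_const 2
  have hU : Measurable U := Finset.measurable_fun_sum _ fun n _ => (hu n).pow_const 2
  -- The extremizer in the duality of L^s and L^t, where s = p/2: it turns the integral of F ^ s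
  -- into the pairing of `F` with `w`, and w ^ t = F ^ s.
  set w := fun y => F y ^ (s - 1)
  have hw : Measurable w := hF.pow_const _
  have hX : ∫⁻ y, F y ^ s ∂μ ≠ ⊤ :=
    MaximallyDominated.lintegral_sum_sq_ne_top (by linarith) hS hu hfin
  have hkey : ∫⁻ y, F y ^ s ∂μ ≤
      (L ^ 2 * C ^ (1 / t) * (∫⁻ y, U y ^ s ∂μ) ^ (1 / s)) * (∫⁻ y, F y ^ s ∂μ) ^ (1 / t) := by
    calc ∫⁻ y, F y ^ s ∂μ = ∫⁻ y, ∑ n, S n (u n) y ^ 2 * w y ∂μ := by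
          refine lintegral_congr fun y => ?_
          rw [← Finset.sum_mul]
          conv_lhs => rw [show s = 1 + (s - 1) by ring,
            ENNReal.rpow_add_of_nonneg _ _ zero_le_one (by linarith), ENNReal.rpow_one]
      _ = ∑ n, ∫⁻ y, S n (u n) y ^ 2 * w y ∂μ :=
          lintegral_finsetSum _ fun n _ => ((hSu n).pow_const 2).mul hw
      _ ≤ ∑ n, L ^ 2 * ∫⁻ y, u n y ^ 2 * (maximalFn μ w y + w y) ∂μ := by
          refine Finset.sum_le_sum fun n _ => ?_
          have hu2 : Measurable fun y => u n y ^ 2 := (hu n).pow_const 2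
          calc ∫⁻ y, S n (u n) y ^ 2 * w y ∂μ
              ≤ ∫⁻ y, L * (S n (fun x => u n x ^ 2) y * w y) ∂μ := by
                refine lintegral_mono fun y => ?_
                rw [← mul_assoc]
                exact mul_le_mul_left ((hS n).sq_le _ (hu n) y) _
            _ = L * ∫⁻ y, u n y ^ 2 * S n w y ∂μ := by
                rw [lintegral_const_mul' _ _ (by simp), (hS n).symm _ _ hu2 hw]
            _ ≤ L * ∫⁻ y, L * (u n y ^ 2 * (maximalFn μ w y + w y)) ∂μ := by
                refine mul_le_mul_right (lintegral_mono fun y => ?_) _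
                rw [mul_left_comm]
                exact mul_le_mul_right ((hS n).le_maximalFn w hw y) _
            _ = _ := by rw [lintegral_const_mul' _ _ (by simp)]; ring
      _ = L ^ 2 * ∫⁻ y, (U * fun y => maximalFn μ w y + w y) y ∂μ := by
          have hm : ∀ n, Measurable fun y => u n y ^ 2 * (maximalFn μ w y + w y) := fun n =>
            ((hu n).pow_const 2).mul ((measurable_maximalFn w).add hw)
          rw [← Finset.mul_sum, ← lintegral_finsetSum _ fun n _ => hm n]
          simp only [Pi.mul_apply, U, Finset.sum_mul]
      _ ≤ L ^ 2 * ((∫⁻ y, U y ^ s ∂μ) ^ (1 / s) *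
            (∫⁻ y, (maximalFn μ w y + w y) ^ t ∂μ) ^ (1 / t)) := by
          gcongr
          exact ENNReal.lintegral_mul_le_Lp_mul_Lq μ hst hU.aemeasurable
            ((measurable_maximalFn w).add hw).aemeasurable
      _ ≤ L ^ 2 * ((∫⁻ y, U y ^ s ∂μ) ^ (1 / s) * (C * ∫⁻ y, F y ^ s ∂μ) ^ (1 / t)) := by
          have ht0 := hst.symm.pos
          gcongr
          refine (hM w hw).trans_eq ?_
          congr 1
          refine lintegral_congr fun y => ?_
          rw [← ENNReal.rpow_mul, hst.sub_one_mul_conj]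
      _ = _ := by
          rw [ENNReal.mul_rpow_of_nonneg _ _ (by have := hst.symm.pos; positivity)]; ring
  refine (le_rpow_of_le_mul_rpow hX hst hkey).trans_eq ?_
  rw [ENNReal.mul_rpow_of_nonneg _ _ hst.nonneg, ← ENNReal.rpow_mul (∫⁻ y, U y ^ s ∂μ),
    one_div_mul_cancel hst.pos.ne', ENNReal.rpow_one]

/-- The square function estimate for `p < 2`, by duality. -/
theorem MaximallyDominated.exists_squareFunction_le_of_lt_two (μ : Measure V) [μ.IsAddHaarMeasure]
    (L : ℝ≥0) {p : ℝ} (hp1 : 1 < p) (hp : p < 2) :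
    ∃ C : ℝ≥0∞, C ≠ ⊤ ∧ ∀ (N : ℕ) (S : Fin N → (V → ℝ≥0∞) → V → ℝ≥0∞)
      (u : Fin N → V → ℝ≥0∞), (∀ n, MaximallyDominated μ L (S n)) → (∀ n, Measurable (u n)) →
      (∀ n, ∫⁻ x, u n x ^ p ∂μ ≠ ⊤) →
      ∫⁻ y, (∑ n, S n (u n) y ^ 2) ^ (p / 2) ∂μ ≤ C * ∫⁻ y, (∑ n, u n y ^ 2) ^ (p / 2) ∂μ := by
  have hst := Real.HolderConjugate.conjExponent hp1
  set q := p.conjExponent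
  have hq0 := hst.symm.pos
  have hq2 : 2 < q := by
    have h1 := hst.sub_one_mul_conj
    nlinarith
  obtain ⟨C, hC, hM⟩ := MaximallyDominated.exists_squareFunction_le_of_two_lt μ L hq2
  refine ⟨(C ^ (1 / q)) ^ p, ENNReal.rpow_ne_top_of_nonneg hst.nonneg
    (ENNReal.rpow_ne_top_of_nonneg (by positivity) hC), fun N S u hS hu hfin => ?_⟩
  set F := fun y => ∑ n, S n (u n) y ^ 2
  set U := fun y => ∑ n, u n y ^ 2
  have hSu : ∀ n, Measurable (S n (u n)) := fun n => (hS n).measurable _ (hu n)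
  have hF : Measurable F := Finset.measurable_fun_sum _ fun n _ => (hSu n).pow_const 2
  have hU : Measurable U := Finset.measurable_fun_sum _ fun n _ => (hu n).pow_const 2
  set w := fun y => F y ^ (p / 2 - 1)
  have hw : Measurable w := hF.pow_const _
  have hX : ∫⁻ y, F y ^ (p / 2) ∂μ ≠ ⊤ :=
    MaximallyDominated.lintegral_sum_sq_ne_top hp1 hS hu hfin
  -- The extremizer for the pairing of L^p(ℓ²) with L^q(ℓ²), q > 2 the conjugate exponent. After
  -- symmetry, the estimate already known for `q` is applied to `h`.
  set h : Fin N → V → ℝ≥0∞ := fun n y => S n (u n) y * w y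
  have hh : ∀ n, Measurable (h n) := fun n => (hSu n).mul hw
  -- The exponent of `w` is negative: where F = 0 the convention 0 * ⊤ = 0 gives the right value,
  -- while the points where F = ⊤ form a null set by finiteness.
  have hFw : ∀ᵐ y ∂μ, F y ^ (p / 2) = F y * w y := by
    filter_upwards [ae_lt_top (hF.pow_const _) hX] with y hy
    have hF1 : F y ≠ ⊤ := by
      intro h0
      rw [h0, ENNReal.top_rpow_of_pos (by linarith)] at hy
      exact absurd hy (by simp)
    rcases eq_or_ne (F y) 0 with h0 | h0
    · rw [h0, ENNReal.zero_rpow_of_pos (by linarith), zero_mul]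
    · conv_lhs => rw [show p / 2 = 1 + (p / 2 - 1) by ring, ENNReal.rpow_add _ _ h0 hF1,
        ENNReal.rpow_one]
  have hH : ∀ y, (∑ n, h n y ^ 2) ^ (q / 2) ≤ F y ^ (p / 2) := by
    intro y
    have h1 : ∑ n, h n y ^ 2 = F y * w y ^ 2 := by
      simp only [h, mul_pow, F, Finset.sum_mul]
    rw [h1]
    rcases eq_or_ne (F y) 0 with h0 | h0
    · rw [h0, zero_mul, ENNReal.zero_rpow_of_pos (by linarith)]; exact zero_le
    rcases eq_or_ne (F y) ⊤ with h2 | h2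
    · rw [h2, ENNReal.top_rpow_of_pos (by linarith)]; exact le_top
    · have h3 : F y * w y ^ 2 = F y ^ (p - 1) := by
        rw [show p - 1 = 1 + (p / 2 - 1) * (2 : ℕ) by push_cast; ring, ENNReal.rpow_add _ _ h0 h2,
          ENNReal.rpow_one, ENNReal.rpow_mul, ENNReal.rpow_natCast]
      rw [h3, ← ENNReal.rpow_mul, ← mul_div_assoc, hst.sub_one_mul_conj]
  have hhfin : ∀ n, ∫⁻ x, h n x ^ q ∂μ ≠ ⊤ := by
    intro n
    refine ne_top_of_le_ne_top hX (lintegral_mono fun y => le_trans ?_ (hH y))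
    calc h n y ^ q = (h n y ^ 2) ^ (q / 2) := by
          rw [← ENNReal.rpow_natCast, ← ENNReal.rpow_mul]; congr 1; push_cast; ring
      _ ≤ _ := by
          gcongr
          exact Finset.single_le_sum (f := fun n => h n y ^ 2) (fun _ _ => zero_le)
            (Finset.mem_univ n)
  have hkey : ∫⁻ y, F y ^ (p / 2) ∂μ ≤ (C ^ (1 / q) * (∫⁻ y, U y ^ (p / 2) ∂μ) ^ (1 / p)) *
      (∫⁻ y, F y ^ (p / 2) ∂μ) ^ (1 / q) := by
    calc ∫⁻ y, F y ^ (p / 2) ∂μ = ∫⁻ y, ∑ n, S n (u n) y * h n y ∂μ := by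
          refine lintegral_congr_ae (hFw.mono fun y hy => ?_)
          simp only [hy, F, Finset.sum_mul, h]
          exact Finset.sum_congr rfl fun n _ => by ring
      _ = ∑ n, ∫⁻ y, S n (u n) y * h n y ∂μ :=
          lintegral_finsetSum _ fun n _ => (hSu n).mul (hh n)
      _ = ∑ n, ∫⁻ y, u n y * S n (h n) y ∂μ :=
          Finset.sum_congr rfl fun n _ => (hS n).symm _ _ (hu n) (hh n)
      _ = ∫⁻ y, ∑ n, u n y * S n (h n) y ∂μ :=
          (lintegral_finsetSum _ fun n _ => (hu n).mul ((hS n).measurable _ (hh n))).symm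
      _ ≤ ∫⁻ y, ((fun y => U y ^ (1 / 2 : ℝ)) *
            fun y => (∑ n, S n (h n) y ^ 2) ^ (1 / 2 : ℝ)) y ∂μ := by
          refine lintegral_mono fun y => ?_
          simpa [U] using ENNReal.inner_le_Lp_mul_Lq Finset.univ (fun n => u n y)
            (fun n => S n (h n) y) Real.HolderConjugate.two_two
      _ ≤ (∫⁻ y, (U y ^ (1 / 2 : ℝ)) ^ p ∂μ) ^ (1 / p) *
            (∫⁻ y, ((∑ n, S n (h n) y ^ 2) ^ (1 / 2 : ℝ)) ^ q ∂μ) ^ (1 / q) :=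
          ENNReal.lintegral_mul_le_Lp_mul_Lq μ hst (hU.pow_const _).aemeasurable
            ((Finset.measurable_fun_sum _ fun n _ =>
              ((hS n).measurable _ (hh n)).pow_const 2).pow_const _).aemeasurable
      _ = (∫⁻ y, U y ^ (p / 2) ∂μ) ^ (1 / p) *
            (∫⁻ y, (∑ n, S n (h n) y ^ 2) ^ (q / 2) ∂μ) ^ (1 / q) := by
          simp_rw [← ENNReal.rpow_mul, one_div_mul_eq_div]
      _ ≤ (∫⁻ y, U y ^ (p / 2) ∂μ) ^ (1 / p) * (C * ∫⁻ y, F y ^ (p / 2) ∂μ) ^ (1 / q) := by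
          gcongr
          refine (hM N S h hS hh hhfin).trans ?_
          gcongr with y
          exact hH y
      _ = _ := by rw [ENNReal.mul_rpow_of_nonneg _ _ (by positivity)]; ring
  refine (le_rpow_of_le_mul_rpow hX hst hkey).trans_eq ?_
  rw [ENNReal.mul_rpow_of_nonneg _ _ hst.nonneg, ← ENNReal.rpow_mul (∫⁻ y, U y ^ (p / 2) ∂μ),
    one_div_mul_cancel hst.pos.ne', ENNReal.rpow_one]

/-- The square function estimate in `L^p`, `1 < p < ∞`. -/
theorem MaximallyDominated.exists_squareFunction_le (μ : Measure V) [μ.IsAddHaarMeasure]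
    (L : ℝ≥0) {p : ℝ} (hp1 : 1 < p) :
    ∃ C : ℝ≥0∞, C ≠ ⊤ ∧ ∀ (N : ℕ) (S : Fin N → (V → ℝ≥0∞) → V → ℝ≥0∞)
      (u : Fin N → V → ℝ≥0∞), (∀ n, MaximallyDominated μ L (S n)) → (∀ n, Measurable (u n)) →
      (∀ n, ∫⁻ x, u n x ^ p ∂μ ≠ ⊤) →
      ∫⁻ y, (∑ n, S n (u n) y ^ 2) ^ (p / 2) ∂μ ≤ C * ∫⁻ y, (∑ n, u n y ^ 2) ^ (p / 2) ∂μ := by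
  rcases lt_trichotomy p 2 with h | rfl | h
  · exact exists_squareFunction_le_of_lt_two μ L hp1 h
  · refine ⟨2 * L ^ 2, by finiteness, fun N S u hS hu _ => ?_⟩
    simp only [div_self (two_ne_zero' ℝ), ENNReal.rpow_one]
    rw [lintegral_finsetSum _ fun n _ => ((hS n).measurable _ (hu n)).pow_const 2,
      lintegral_finsetSum _ fun n _ => (hu n).pow_const 2, Finset.mul_sum]
    exact Finset.sum_le_sum fun n _ => (hS n).lintegral_sq_le (hu n)
  · exact exists_squareFunction_le_of_two_lt μ L h

end Dominated

/-! ### Mixtures of ball averages and radial majorants -/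

section Mixture

variable {V : Type*} [NormedAddCommGroup V] [MeasurableSpace V]

/-- The radial kernel `z ↦ ∫_{‖z‖ < s‖v‖} ρ(v) dv`, a mixture of indicator functions of balls. -/
def ballMixture (μ : Measure V) (ρ : V → ℝ≥0∞) (s : ℝ) (z : V) : ℝ≥0∞ :=
  ∫⁻ v, (if ‖z‖ < s * ‖v‖ then ρ v else 0) ∂μ

/-- The operator `u ↦ κ u + k ∗ u`, for the mixture `k` of balls with weight `ρ`. -/
def mixtureOp (μ : Measure V) (κ : ℝ≥0∞) (ρ : V → ℝ≥0∞) (s : ℝ) (u : V → ℝ≥0∞) (y : V) : ℝ≥0∞ :=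
  κ * u y + ∫⁻ x, ballMixture μ ρ s (x - y) * u x ∂μ

theorem measurable_measure_ball (μ : Measure V) :
    Measurable fun r : ℝ => μ (Metric.ball (0 : V) r) := by
  have : Monotone fun r : ℝ => μ (Metric.ball (0 : V) r) :=
    fun _ _ h => measure_mono (Metric.ball_subset_ball h)
  exact this.measurable

theorem ballMixture_sub_comm (μ : Measure V) (ρ : V → ℝ≥0∞) (s : ℝ) (x y : V) :
    ballMixture μ ρ s (x - y) = ballMixture μ ρ s (y - x) := by
  simp only [ballMixture, norm_sub_rev x y]

variable [BorelSpace V] {μ : Measure V} [SFinite μ]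

theorem measurable_ballMixture {ρ : V → ℝ≥0∞} (hρ : Measurable ρ) (s : ℝ) :
    Measurable (ballMixture μ ρ s) := by
  refine Measurable.lintegral_prod_right' (f := fun w : V × V =>
    if ‖w.1‖ < s * ‖w.2‖ then ρ w.2 else 0) ?_
  exact Measurable.ite (measurableSet_lt (by fun_prop) (by fun_prop)) (by fun_prop)
    measurable_const

variable [SecondCountableTopology V]

theorem measurable_ballMixture_sub {ρ : V → ℝ≥0∞} (hρ : Measurable ρ) (s : ℝ) :
    Measurable fun w : V × V => ballMixture μ ρ s (w.2 - w.1) :=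
  (measurable_ballMixture hρ s).comp (measurable_snd.sub measurable_fst)

theorem measurable_mixtureOp (κ : ℝ≥0∞) {ρ : V → ℝ≥0∞} (hρ : Measurable ρ) (s : ℝ)
    {u : V → ℝ≥0∞} (hu : Measurable u) : Measurable (mixtureOp μ κ ρ s u) := by
  refine (hu.const_mul κ).add (Measurable.lintegral_prod_right' (f := fun w : V × V =>
    ballMixture μ ρ s (w.2 - w.1) * u w.2) ?_)
  exact (measurable_ballMixture_sub hρ s).mul (hu.comp measurable_snd)

/-- Tonelli's theorem and the evenness of the convolution kernel. -/
theorem lintegral_mixtureOp_mul (κ : ℝ≥0∞) {ρ : V → ℝ≥0∞} (hρ : Measurable ρ) (s : ℝ)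
    {u w : V → ℝ≥0∞} (hu : Measurable u) (hw : Measurable w) :
    ∫⁻ y, mixtureOp μ κ ρ s u y * w y ∂μ = ∫⁻ y, u y * mixtureOp μ κ ρ s w y ∂μ := by
  have hk := measurable_ballMixture_sub (μ := μ) hρ s
  have hsec : ∀ y, Measurable fun x => ballMixture μ ρ s (x - y) := fun y =>
    (measurable_ballMixture hρ s).comp (measurable_id.sub_const y)
  have hD : ∫⁻ y, (∫⁻ x, ballMixture μ ρ s (x - y) * u x ∂μ) * w y ∂μ =
      ∫⁻ y, u y * ∫⁻ x, ballMixture μ ρ s (x - y) * w x ∂μ ∂μ := by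
    calc _ = ∫⁻ y, ∫⁻ x, ballMixture μ ρ s (x - y) * u x * w y ∂μ ∂μ :=
          lintegral_congr fun y => (lintegral_mul_const _ ((hsec y).mul hu)).symm
      _ = ∫⁻ x, ∫⁻ y, ballMixture μ ρ s (x - y) * u x * w y ∂μ ∂μ :=
          lintegral_lintegral_swap
            ((hk.mul (hu.comp measurable_snd)).mul (hw.comp measurable_fst)).aemeasurable
      _ = _ := by
          refine lintegral_congr fun x => ?_
          have hm : Measurable fun y => ballMixture μ ρ s (y - x) * w y := (hsec x).mul hw
          rw [← lintegral_const_mul _ hm]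
          refine lintegral_congr fun y => ?_
          rw [ballMixture_sub_comm]; ring
  have hm1 : Measurable fun y => κ * u y * w y := (hu.const_mul κ).mul hw
  have hm2 : Measurable fun y => u y * (κ * w y) := hu.mul (hw.const_mul κ)
  simp only [mixtureOp, add_mul, mul_add]
  rw [lintegral_add_left hm1, hD, lintegral_add_left hm2]
  congr 1
  exact lintegral_congr fun y => by ring

variable [NormedSpace ℝ V] [FiniteDimensional ℝ V] [μ.IsAddHaarMeasure]

omit [SFinite μ] in
-- By Tonelli the convolution is a superposition of integrals over balls centred at `y`, each at
-- most the volume of the ball times the maximal function. The volumes add up to the mass of the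
-- kernel.
theorem mixtureOp_le_maximalFn (κ : ℝ≥0∞) {ρ : V → ℝ≥0∞} (hρ : Measurable ρ) {s : ℝ} (hs : 0 < s)
    {L : ℝ≥0} (hL : κ + ∫⁻ v, ρ v * μ (Metric.ball 0 (s * ‖v‖)) ∂μ ≤ L)
    {u : V → ℝ≥0∞} (hu : Measurable u) (y : V) :
    mixtureOp μ κ ρ s u y ≤ L * (maximalFn μ u y + u y) := by
  have h1 : ∫⁻ x, ballMixture μ ρ s (x - y) * u x ∂μ ≤
      (∫⁻ v, ρ v * μ (Metric.ball 0 (s * ‖v‖)) ∂μ) * maximalFn μ u y := by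
    have hm : Measurable fun w : V × V => if ‖w.1 - y‖ < s * ‖w.2‖ then ρ w.2 else 0 :=
      Measurable.ite (measurableSet_lt (by fun_prop) (by fun_prop)) (by fun_prop) measurable_const
    calc _ = ∫⁻ x, ∫⁻ v, (if ‖x - y‖ < s * ‖v‖ then ρ v else 0) * u x ∂μ ∂μ := by
          refine lintegral_congr fun x => (lintegral_mul_const _ ?_).symm
          exact hm.comp measurable_prodMk_left
      _ = ∫⁻ v, ∫⁻ x, (if ‖x - y‖ < s * ‖v‖ then ρ v else 0) * u x ∂μ ∂μ :=
          lintegral_lintegral_swap (hm.mul (hu.comp measurable_fst)).aemeasurable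
      _ ≤ ∫⁻ v, ρ v * μ (Metric.ball 0 (s * ‖v‖)) * maximalFn μ u y ∂μ := by
          refine lintegral_mono fun v => ?_
          have h2 : ∀ x, (if ‖x - y‖ < s * ‖v‖ then ρ v else 0) * u x =
              ρ v * (Metric.ball y (s * ‖v‖)).indicator u x := by
            intro x
            by_cases h : ‖x - y‖ < s * ‖v‖ <;> simp [Set.indicator, dist_eq_norm, h]
          simp_rw [h2]
          rw [lintegral_const_mul _ (hu.indicator measurableSet_ball),
            lintegral_indicator measurableSet_ball, mul_assoc]
          gcongr
          rcases eq_or_ne v 0 with rfl | hv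
          · simp
          have hr : 0 < s * ‖v‖ := by positivity
          calc ∫⁻ x in Metric.ball y (s * ‖v‖), u x ∂μ
              = μ (Metric.ball 0 (s * ‖v‖)) * ((μ (Metric.ball 0 (s * ‖v‖)))⁻¹ *
                ∫⁻ x in Metric.ball y (s * ‖v‖), u x ∂μ) := by
                rw [← mul_assoc, ENNReal.mul_inv_cancel (Metric.measure_ball_pos μ 0 hr).ne'
                  measure_ball_lt_top.ne, one_mul]
            _ ≤ _ := by gcongr; exact average_le_maximalFn u y hr
      _ = _ := by
          exact lintegral_mul_const _ (hρ.mul ((measurable_measure_ball μ).comp (by fun_prop)))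
  have h2 := le_self_add.trans hL
  have h3 := le_add_self.trans hL
  calc mixtureOp μ κ ρ s u y ≤ L * u y + L * maximalFn μ u y := by
        unfold mixtureOp
        gcongr
        exact h1.trans (by gcongr)
    _ = _ := by ring

omit [SecondCountableTopology V] [FiniteDimensional ℝ V] [SFinite μ]
  [NormedSpace ℝ V] [μ.IsAddHaarMeasure] in
-- Cauchy–Schwarz for the measure that represents the operator at `y`: a Dirac mass with weight κ
-- plus the translated kernel, of total mass at most `L`.
theorem mixtureOp_sq_le (κ : ℝ≥0∞) {ρ : V → ℝ≥0∞} {s : ℝ} (hk : Measurable (ballMixture μ ρ s))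
    {L : ℝ≥0∞} (hL : ∀ y, mixtureOp μ κ ρ s (fun _ => 1) y ≤ L)
    {u : V → ℝ≥0∞} (hu : Measurable u) (y : V) :
    mixtureOp μ κ ρ s u y ^ 2 ≤ L * mixtureOp μ κ ρ s (fun x => u x ^ 2) y := by
  set ν : Measure V := κ • Measure.dirac y + μ.withDensity fun x => ballMixture μ ρ s (x - y)
  have hk' : Measurable fun x => ballMixture μ ρ s (x - y) := hk.comp (measurable_id.sub_const y)
  have hν : ∀ f : V → ℝ≥0∞, Measurable f → mixtureOp μ κ ρ s f y = ∫⁻ x, f x ∂ν := by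
    intro f hf
    rw [lintegral_add_measure, lintegral_smul_measure, lintegral_dirac' _ hf,
      lintegral_withDensity_eq_lintegral_mul _ hk' hf]
    rfl
  have h := ENNReal.lintegral_mul_le_Lp_mul_Lq ν Real.HolderConjugate.two_two
    (f := fun _ => 1) (g := u) aemeasurable_const hu.aemeasurable
  have h1 := hL y
  rw [hν _ measurable_const] at h1
  rw [hν u hu, hν _ (hu.pow_const 2)]
  simp only [Pi.mul_apply, one_mul, ENNReal.one_rpow] at h
  calc (∫⁻ x, u x ∂ν) ^ 2 ≤ ((∫⁻ _, 1 ∂ν) ^ (1 / 2 : ℝ) *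
        (∫⁻ x, u x ^ (2 : ℝ) ∂ν) ^ (1 / 2 : ℝ)) ^ 2 := by gcongr
    _ = (∫⁻ _, 1 ∂ν) * ∫⁻ x, u x ^ 2 ∂ν := by
        simp only [mul_pow, ← ENNReal.rpow_natCast, ← ENNReal.rpow_mul]
        norm_num
    _ ≤ _ := by gcongr

/-- Mixtures of ball averages of bounded total mass are dominated by the maximal function. -/
theorem maximallyDominated_mixtureOp (μ : Measure V) [μ.IsAddHaarMeasure] (κ : ℝ≥0∞)
    {ρ : V → ℝ≥0∞} (hρ : Measurable ρ) {s : ℝ} (hs : 0 < s) {L : ℝ≥0}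
    (hL : κ + ∫⁻ v, ρ v * μ (Metric.ball 0 (s * ‖v‖)) ∂μ ≤ L) :
    MaximallyDominated μ (2 * L) (mixtureOp μ κ ρ s) where
  measurable u hu := measurable_mixtureOp κ hρ s hu
  symm u w hu hw := lintegral_mixtureOp_mul κ hρ s hu hw
  sq_le u hu y := by
    -- The mass bound comes from applying the maximal estimate to the constant 1, giving L(1 + 1);
    -- hence the factor 2.
    refine mixtureOp_sq_le κ (measurable_ballMixture hρ s) (fun y => ?_) hu y
    refine (mixtureOp_le_maximalFn κ hρ hs hL measurable_const y).trans ?_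
    rw [mul_comm (2 : ℝ≥0), ENNReal.coe_mul]
    gcongr
    rw [ENNReal.coe_ofNat, ← one_add_one_eq_two]
    gcongr
    exact maximalFn_one_le y
  le_maximalFn u hu y := by
    refine (mixtureOp_le_maximalFn κ hρ hs hL hu y).trans ?_
    gcongr
    exact le_mul_of_one_le_left (by positivity) (by norm_num)

end Mixture

/-! ### Radial majorants bounded by mixtures of balls -/

section RadialMajorant

variable {d : ℕ}

/-- The least radially decreasing majorant of `|G|`, as a function of the radius. -/
def radialMajorant (G : E d → ℝ) (r : ℝ) : ℝ≥0∞ :=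
  essSup (fun y => ‖G y‖ₑ) (volume.restrict {y : E d | r ≤ ‖y‖})

theorem antitone_radialMajorant (G : E d → ℝ) : Antitone (radialMajorant G) := by
  intro r s h
  refine essSup_mono_measure (Measure.restrict_mono ?_ le_rfl).absolutelyContinuous
  exact fun y hy => h.trans hy

/-- Each essential supremum has its own exceptional null set, so only rational radii are used; a
rational strictly between `r` and the norm, and monotonicity, give all radii. -/
theorem ae_enorm_le_radialMajorant (G : E d → ℝ) :
    ∀ᵐ z : E d, ∀ r < ‖z‖, ‖G z‖ₑ ≤ radialMajorant G r := by
  have h : ∀ᵐ z : E d, ∀ q : ℚ, (q : ℝ) ≤ ‖z‖ → ‖G z‖ₑ ≤ radialMajorant G q := by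
    rw [ae_all_iff]
    intro q
    have := ENNReal.ae_le_essSup (μ := volume.restrict {y : E d | (q : ℝ) ≤ ‖y‖}) fun y => ‖G y‖ₑ
    exact (ae_restrict_iff' (measurableSet_le measurable_const measurable_norm)).1 this
  filter_upwards [h] with z hz r hr
  obtain ⟨q, h1, h2⟩ := exists_rat_btwn hr
  exact (hz q h2.le).trans (antitone_radialMajorant G h1.le)

/-- The weight for which the mixture of balls majorizes `G`. -/
def majorantWeight (G : E d → ℝ) (v : E d) : ℝ≥0∞ :=
  2 * (volume (Metric.ball (0 : E d) ‖v‖))⁻¹ * radialMajorant G ‖v‖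

theorem measurable_majorantWeight (G : E d → ℝ) : Measurable (majorantWeight G) := by
  exact (((measurable_measure_ball volume).comp measurable_norm).inv.const_mul 2).mul
    ((antitone_radialMajorant G).measurable.comp measurable_norm)

/-- The weight contains the reciprocal volume of the ball of radius ‖v‖, and tripling the radius
costs 3 ^ d: the mass of the mixture is controlled by the integral of the radial majorant. -/
theorem lintegral_majorantWeight_le (G : E d → ℝ) :
    ∫⁻ v, majorantWeight G v * volume (Metric.ball (0 : E d) (3 * ‖v‖)) ≤
      2 * 3 ^ d * radialMajorantIntegral G := by
  rw [radialMajorantIntegral, ← lintegral_const_mul' _ _ (by finiteness)]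
  refine lintegral_mono fun v => ?_
  have h3 : volume (Metric.ball (0 : E d) (3 * ‖v‖)) =
      3 ^ d * volume (Metric.ball (0 : E d) ‖v‖) := by
    rw [Measure.addHaar_ball_mul_of_pos _ _ (by norm_num), finrank_euclideanSpace_fin,
      ENNReal.ofReal_pow (by norm_num)]
    norm_num
  rw [h3, majorantWeight]
  calc _ = 2 * 3 ^ d * ((volume (Metric.ball (0 : E d) ‖v‖))⁻¹ *
        volume (Metric.ball (0 : E d) ‖v‖)) * radialMajorant G ‖v‖ := by ring
    _ ≤ 2 * 3 ^ d * 1 * radialMajorant G ‖v‖ := by gcongr; exact ENNReal.inv_mul_le_one _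
    _ = _ := by rw [mul_one]; rfl

/-- On the annulus ‖z‖/2 ≤ ‖v‖ < ‖z‖ the weight is at least 2‖G z‖ₑ divided by the volume of the
ball of radius ‖z‖, and since d ≥ 1 the annulus fills at least half of that ball. A dilation factor
above 2 makes ‖z‖ < 3‖v‖ strict there. -/
theorem ae_enorm_le_ballMixture [Nontrivial (E d)] (G : E d → ℝ) :
    ∀ᵐ z : E d, ‖G z‖ₑ ≤ ballMixture volume (majorantWeight G) 3 z := by
  have hd : d ≠ 0 := by
    have := Module.finrank_pos (R := ℝ) (M := E d)
    rw [finrank_euclideanSpace_fin] at this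
    exact this.ne'
  have h0 : ∀ᵐ z : E d, z ≠ 0 := by simp [ae_iff]
  filter_upwards [ae_enorm_le_radialMajorant G, h0] with z hz hz0
  have hzn : 0 < ‖z‖ := norm_pos_iff.2 hz0
  set b := volume (Metric.ball (0 : E d) ‖z‖)
  have hb0 : b ≠ 0 := (Metric.measure_ball_pos volume 0 hzn).ne'
  have hb1 : b ≠ ⊤ := measure_ball_lt_top.ne
  set Ann := Metric.ball (0 : E d) ‖z‖ \ Metric.ball 0 (2⁻¹ * ‖z‖)
  have hAnn : MeasurableSet Ann := measurableSet_ball.diff measurableSet_ball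
  have hhalf : volume (Metric.ball (0 : E d) (2⁻¹ * ‖z‖)) ≤ b / 2 := by
    rw [Measure.addHaar_ball_mul_of_pos _ _ (by norm_num), finrank_euclideanSpace_fin,
      ENNReal.div_eq_inv_mul]
    gcongr
    rw [ENNReal.ofReal_pow (by norm_num), ENNReal.ofReal_inv_of_pos (by norm_num),
      ENNReal.ofReal_ofNat]
    exact pow_le_of_le_one (by positivity) (by simp) hd
  have hvol : b / 2 ≤ volume Ann := by
    refine le_trans ?_ (le_measure_sdiff)
    rw [← ENNReal.sub_half hb1]
    gcongr
  calc ‖G z‖ₑ = 2 * b⁻¹ * ‖G z‖ₑ * (b / 2) := by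
        rw [div_eq_mul_inv, show 2 * b⁻¹ * ‖G z‖ₑ * (b * 2⁻¹) =
          (2 * 2⁻¹) * (b⁻¹ * b) * ‖G z‖ₑ by ring,
          ENNReal.mul_inv_cancel (by simp) (by simp), ENNReal.inv_mul_cancel hb0 hb1]
        simp
    _ ≤ 2 * b⁻¹ * ‖G z‖ₑ * volume Ann := by gcongr
    _ = ∫⁻ _ in Ann, 2 * b⁻¹ * ‖G z‖ₑ := by rw [setLIntegral_const]
    _ ≤ ∫⁻ v in Ann, (if ‖z‖ < 3 * ‖v‖ then majorantWeight G v else 0) := by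
        refine setLIntegral_mono' hAnn fun v hv => ?_
        have h1 : ‖v‖ < ‖z‖ := by simpa using hv.1
        have h2 : 2⁻¹ * ‖z‖ ≤ ‖v‖ := by simpa using hv.2
        rw [if_pos (by linarith), majorantWeight]
        gcongr
        · exact measure_mono (Metric.ball_subset_ball h1.le)
        · exact hz _ h1
    _ ≤ _ := setLIntegral_le_lintegral _ _

/-- Rescaling of a mixture of balls. -/
theorem ballMixture_smul (ρ : E d → ℝ≥0∞) (s : ℝ) {c : ℝ} (hc : 0 < c) (a : ℝ≥0∞) (ha : a ≠ ⊤)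
    (z : E d) :
    a * ballMixture volume ρ s (c⁻¹ • z) =
      ballMixture volume (fun v => a * ρ v) (c * s) z := by
  rw [ballMixture, ← lintegral_const_mul' _ _ ha]
  refine lintegral_congr fun v => ?_
  have : ‖c⁻¹ • z‖ < s * ‖v‖ ↔ ‖z‖ < c * s * ‖v‖ := by
    rw [norm_smul, Real.norm_of_nonneg (by positivity), inv_mul_lt_iff₀ hc, mul_assoc]
  simp [this]

/-- The rescaled kernel `c^{-d} G((x-y)/c)` acts, up to a constant, below an operator dominated by
the maximal function. -/
theorem exists_mixtureOp_majorant (hd : 0 < d) {c : ℝ} (hc : 0 < c) (κ : ℝ≥0) (A : ℝ≥0) (K : ℝ≥0) :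
    ∃ L : ℝ≥0, ∀ G : E d → ℝ, radialMajorantIntegral G ≤ K →
      ∃ (ρ : E d → ℝ≥0∞) (s : ℝ), Measurable ρ ∧
        MaximallyDominated volume L (mixtureOp volume κ ρ s) ∧
        ∀ᵐ z : E d, A * ENNReal.ofReal (c ^ d)⁻¹ * ‖G (c⁻¹ • z)‖ₑ ≤ ballMixture volume ρ s z := by
  have : Nonempty (Fin d) := ⟨⟨0, hd⟩⟩
  -- No power of `c` appears: the factor c^{-d} of the kernel cancels the growth of the rescaled
  -- balls.
  refine ⟨2 * (κ + A * (2 * 3 ^ d * K)), fun G hG => ?_⟩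
  set a : ℝ≥0∞ := A * ENNReal.ofReal (c ^ d)⁻¹
  have ha : a ≠ ⊤ := by finiteness
  have hρ : Measurable fun v => a * majorantWeight G v := (measurable_majorantWeight G).const_mul a
  refine ⟨fun v => a * majorantWeight G v, c * 3, hρ, ?_, ?_⟩
  · refine maximallyDominated_mixtureOp volume κ hρ (by positivity) ?_
    push_cast
    gcongr
    have h1 : ∀ v : E d, a * majorantWeight G v * volume (Metric.ball (0 : E d) (c * 3 * ‖v‖)) =
        A * (majorantWeight G v * volume (Metric.ball (0 : E d) (3 * ‖v‖))) := by
      intro v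
      have hcd : ENNReal.ofReal (c ^ d)⁻¹ * ENNReal.ofReal (c ^ d) = 1 := by
        rw [← ENNReal.ofReal_mul (by positivity), inv_mul_cancel₀ (by positivity),
          ENNReal.ofReal_one]
      rw [mul_assoc c, Measure.addHaar_ball_mul_of_pos _ _ hc, finrank_euclideanSpace_fin]
      calc _ = A * (ENNReal.ofReal (c ^ d)⁻¹ * ENNReal.ofReal (c ^ d)) *
            (majorantWeight G v * volume (Metric.ball (0 : E d) (3 * ‖v‖))) := by
            simp only [a]; ring
        _ = _ := by rw [hcd, mul_one]
    simp_rw [h1]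
    rw [lintegral_const_mul' _ _ (by simp)]
    gcongr
    exact (lintegral_majorantWeight_le G).trans (by gcongr)
  · have hqmp : Measure.QuasiMeasurePreserving (fun z : E d => c⁻¹ • z) volume volume :=
      Measure.quasiMeasurePreserving_smul volume (inv_ne_zero hc.ne')
    filter_upwards [hqmp.ae (ae_enorm_le_ballMixture G)] with z hz
    rw [← ballMixture_smul _ _ hc a ha]
    gcongr

end RadialMajorant

/-! ### Khintchine's inequality -/

section Khintchine

/-- The signed sum `∑ₙ sₙ aₙ`. -/
def signSum {X : Type*} [AddCommGroup X] {N : ℕ} (a : Fin N → X) (s : Fin N → ℤˣ) : X :=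
  ∑ n, (s n : ℤ) • a n

theorem card_signs (N : ℕ) : Fintype.card (Fin N → ℤˣ) = 2 ^ N := by
  simp [Fintype.card_units_int]

/-- Independence factors the exponential moment into hyperbolic cosines, each sub-Gaussian: cosh x ≤
exp(x²/2). -/
theorem sum_exp_signSum_le {N : ℕ} (a : Fin N → ℝ) :
    ∑ s, Real.exp (signSum a s) ≤ 2 ^ N * Real.exp ((∑ n, a n ^ 2) / 2) := by
  have h1 : ∑ s : Fin N → ℤˣ, Real.exp (signSum a s) = ∏ n, (2 * Real.cosh (a n)) := by
    have h2 : ∀ n, 2 * Real.cosh (a n) = ∑ e : ℤˣ, Real.exp ((e : ℤ) • a n) := by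
      intro n
      rw [Real.cosh_eq, show (Finset.univ : Finset ℤˣ) = {1, -1} from rfl,
        Finset.sum_pair (by decide)]
      simp
      ring
    simp_rw [h2]
    rw [Finset.prod_univ_sum, Fintype.piFinset_univ]
    refine Finset.sum_congr rfl fun s _ => ?_
    rw [signSum, Real.exp_sum]
  rw [h1, Finset.prod_mul_distrib, Finset.prod_const, Finset.card_univ, Fintype.card_fin,
    Finset.sum_div, Real.exp_sum]
  gcongr with n
  exact Real.cosh_le_exp_half_sq (a n)

theorem sum_exp_abs_signSum_le {N : ℕ} (a : Fin N → ℝ) :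
    ∑ s, Real.exp |signSum a s| ≤ 2 * 2 ^ N * Real.exp ((∑ n, a n ^ 2) / 2) := by
  have hneg : ∀ s : Fin N → ℤˣ, -signSum a s = signSum (fun n => -a n) s := fun s => by
    simp [signSum]
  calc ∑ s, Real.exp |signSum a s|
      ≤ ∑ s, (Real.exp (signSum a s) + Real.exp (signSum (fun n => -a n) s)) := by
        refine Finset.sum_le_sum fun s _ => ?_
        rw [← hneg]
        rcases abs_cases (signSum a s) with ⟨h, _⟩ | ⟨h, _⟩ <;> rw [h] <;>
          linarith [Real.exp_pos (signSum a s), Real.exp_pos (-signSum a s)]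
    _ ≤ 2 ^ N * Real.exp ((∑ n, a n ^ 2) / 2) + 2 ^ N * Real.exp ((∑ n, (-a n) ^ 2) / 2) := by
        rw [Finset.sum_add_distrib]
        exact add_le_add (sum_exp_signSum_le a) (sum_exp_signSum_le _)
    _ = _ := by simp only [neg_sq]; ring

theorem re_signSum {N : ℕ} (a : Fin N → ℂ) (s : Fin N → ℤˣ) :
    (signSum a s).re = signSum (fun n => (a n).re) s := by
  simp [signSum]

theorem im_signSum {N : ℕ} (a : Fin N → ℂ) (s : Fin N → ℤˣ) :
    (signSum a s).im = signSum (fun n => (a n).im) s := by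
  simp [signSum]

/-- The real and imaginary parts are separated by exp(x + y) ≤ (exp(2x) + exp(2y))/2. The doubled
coefficients have square sum at most 4, whence exp 2. -/
theorem sum_exp_norm_signSum_le {N : ℕ} (a : Fin N → ℂ) (ha : ∑ n, ‖a n‖ ^ 2 ≤ 1) :
    ∑ s, Real.exp ‖signSum a s‖ ≤ 2 ^ N * (2 * Real.exp 2) := by
  have htwo : ∀ (b : Fin N → ℝ) (s : Fin N → ℤˣ),
      2 * signSum b s = signSum (fun n => 2 * b n) s := fun b s => by
    simp only [signSum, Finset.mul_sum]
    exact Finset.sum_congr rfl fun n _ => by rw [mul_smul_comm]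
  have hbd : ∀ b : Fin N → ℝ, (∀ n, |b n| ≤ ‖a n‖) →
      ∑ s, Real.exp |signSum (fun n => 2 * b n) s| ≤ 2 * 2 ^ N * Real.exp 2 := by
    intro b hb
    refine (sum_exp_abs_signSum_le _).trans ?_
    gcongr
    have : ∑ n, (2 * b n) ^ 2 ≤ ∑ n, 4 * ‖a n‖ ^ 2 := by
      refine Finset.sum_le_sum fun n _ => ?_
      have := pow_le_pow_left₀ (abs_nonneg _) (hb n) 2
      rw [sq_abs] at this
      nlinarith
    rw [← Finset.mul_sum] at this
    linarith
  calc ∑ s, Real.exp ‖signSum a s‖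
      ≤ ∑ s, (Real.exp |signSum (fun n => 2 * (a n).re) s| +
          Real.exp |signSum (fun n => 2 * (a n).im) s|) / 2 := by
        refine Finset.sum_le_sum fun s _ => ?_
        have h1 := Complex.norm_le_abs_re_add_abs_im (signSum a s)
        rw [← htwo, ← htwo, ← re_signSum, ← im_signSum, abs_mul, abs_mul, abs_two]
        set x := |(signSum a s).re|
        set y := |(signSum a s).im|
        have h2 : Real.exp ‖signSum a s‖ ≤ Real.exp x * Real.exp y := by
          rw [← Real.exp_add]; gcongr
        have h3 : Real.exp (2 * x) = Real.exp x ^ 2 := by rw [sq, ← Real.exp_add]; ring_nf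
        have h4 : Real.exp (2 * y) = Real.exp y ^ 2 := by rw [sq, ← Real.exp_add]; ring_nf
        rw [h3, h4]
        nlinarith [sq_nonneg (Real.exp x - Real.exp y)]
    _ = (∑ s, Real.exp |signSum (fun n => 2 * (a n).re) s| +
          ∑ s, Real.exp |signSum (fun n => 2 * (a n).im) s|) / 2 := by
        rw [← Finset.sum_div, Finset.sum_add_distrib]
    _ ≤ (2 * 2 ^ N * Real.exp 2 + 2 * 2 ^ N * Real.exp 2) / 2 := by
        gcongr
        · exact hbd _ fun n => Complex.abs_re_le_norm _
        · exact hbd _ fun n => Complex.abs_im_le_norm _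
    _ = _ := by ring

theorem exists_rpow_le_mul_exp (q : ℝ) (hq : 0 < q) :
    ∃ C : ℝ, 0 < C ∧ ∀ x : ℝ, 0 ≤ x → x ^ q ≤ C * Real.exp x := by
  set m := ⌈q⌉₊
  have hm : q ≤ m := Nat.le_ceil q
  refine ⟨1 + (m.factorial : ℝ), by positivity, fun x hx => ?_⟩
  have h1 : x ^ q ≤ 1 + x ^ m := by
    rcases le_total x 1 with h | h
    · have := Real.rpow_le_one hx h hq.le
      have : 0 ≤ x ^ m := by positivity
      linarith
    · have := Real.rpow_le_rpow_of_exponent_le h hm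
      rw [Real.rpow_natCast] at this
      linarith
  have h2 := Real.pow_div_factorial_le_exp x hx m
  rw [div_le_iff₀ (by positivity)] at h2
  have h3 : 1 ≤ Real.exp x := Real.one_le_exp hx
  nlinarith

theorem norm_signSum_smul {N : ℕ} (a : Fin N → ℂ) (t : ℝ) (s : Fin N → ℤˣ) :
    ‖signSum (fun n => (t : ℂ) * a n) s‖ = |t| * ‖signSum a s‖ := by
  have : signSum (fun n => (t : ℂ) * a n) s = t * signSum a s := by
    simp only [signSum, Finset.mul_sum]
    exact Finset.sum_congr rfl fun n _ => by rw [mul_smul_comm]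
  rw [this, norm_mul, Complex.norm_real, Real.norm_eq_abs]

/-- Normalization: an inequality between moments of signed sums that is homogeneous follows
from the case `∑ ‖aₙ‖² = 1`. -/
theorem exists_normalized {N : ℕ} (a : Fin N → ℂ) (h0 : ∑ n, ‖a n‖ ^ 2 ≠ 0) :
    ∃ (σ : ℝ) (b : Fin N → ℂ), 0 < σ ∧ ∑ n, ‖a n‖ ^ 2 = σ ^ 2 ∧ ∑ n, ‖b n‖ ^ 2 = 1 ∧
      ∀ s, ‖signSum a s‖ = σ * ‖signSum b s‖ := by
  set S := ∑ n, ‖a n‖ ^ 2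
  have hS : 0 < S := lt_of_le_of_ne (by positivity) h0.symm
  have hσ : 0 < Real.sqrt S := Real.sqrt_pos.2 hS
  refine ⟨Real.sqrt S, fun n => (((Real.sqrt S)⁻¹ : ℝ) : ℂ) * a n, hσ, (Real.sq_sqrt hS.le).symm,
    ?_, fun s => ?_⟩
  · simp only [norm_mul, Complex.norm_real, Real.norm_eq_abs, mul_pow, ← Finset.mul_sum, sq_abs,
      inv_pow]
    rw [Real.sq_sqrt hS.le, inv_mul_cancel₀ h0]
  · rw [norm_signSum_smul, abs_of_pos (by positivity), ← mul_assoc, mul_inv_cancel₀ hσ.ne', one_mul]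

theorem signSum_eq_zero_of_sum_sq {N : ℕ} (a : Fin N → ℂ) (h0 : ∑ n, ‖a n‖ ^ 2 = 0)
    (s : Fin N → ℤˣ) : signSum a s = 0 := by
  rw [Finset.sum_eq_zero_iff_of_nonneg fun n _ => by positivity] at h0
  exact Finset.sum_eq_zero fun n hn => by
    have := h0 n hn
    simp only [pow_eq_zero_iff two_ne_zero, norm_eq_zero] at this
    simp [this]

/-- Khintchine's inequality, upper bound. -/
theorem exists_sum_norm_signSum_rpow_le (q : ℝ) (hq : 0 < q) :
    ∃ C : ℝ, 0 < C ∧ ∀ (N : ℕ) (a : Fin N → ℂ),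
      ∑ s, ‖signSum a s‖ ^ q ≤ C * 2 ^ N * (∑ n, ‖a n‖ ^ 2) ^ (q / 2) := by
  obtain ⟨C, hC, h⟩ := exists_rpow_le_mul_exp q hq
  refine ⟨C * (2 * Real.exp 2), by positivity, fun N a => ?_⟩
  by_cases h0 : ∑ n, ‖a n‖ ^ 2 = 0
  · simp only [signSum_eq_zero_of_sum_sq a h0, norm_zero, Real.zero_rpow hq.ne',
      Finset.sum_const_zero]
    positivity
  obtain ⟨σ, b, hσ, ha, hb, hab⟩ := exists_normalized a h0
  have h1 : ∑ s, ‖signSum b s‖ ^ q ≤ C * (2 ^ N * (2 * Real.exp 2)) := by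
    refine le_trans ?_ (mul_le_mul_of_nonneg_left (sum_exp_norm_signSum_le b hb.le) hC.le)
    rw [Finset.mul_sum]
    exact Finset.sum_le_sum fun s _ => h _ (norm_nonneg _)
  have h2 : (σ ^ 2) ^ (q / 2) = σ ^ q := by
    rw [← Real.rpow_natCast, ← Real.rpow_mul hσ.le]; congr 1; push_cast; ring
  rw [ha, h2]
  simp only [hab, Real.mul_rpow hσ.le (norm_nonneg _), ← Finset.mul_sum]
  calc σ ^ q * ∑ s, ‖signSum b s‖ ^ q ≤ σ ^ q * (C * (2 ^ N * (2 * Real.exp 2))) := by gcongr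
    _ = _ := by ring

/-- Orthogonality of independent signs. -/
theorem sum_norm_signSum_sq {N : ℕ} (a : Fin N → ℂ) :
    ∑ s, ‖signSum a s‖ ^ 2 = 2 ^ N * ∑ n, ‖a n‖ ^ 2 := by
  induction N with
  | zero => simp [signSum]
  | succ N ih =>
    rw [← (Fin.consEquiv fun _ : Fin (N + 1) => ℤˣ).sum_comp, Fintype.sum_prod_type,
      show (Finset.univ : Finset ℤˣ) = {1, -1} from rfl, Finset.sum_pair (by decide),
      ← Finset.sum_add_distrib]
    have h : ∀ (e : ℤˣ) (s : Fin N → ℤˣ), signSum a (Fin.consEquiv (fun _ => ℤˣ) (e, s)) =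
        (e : ℤ) • a 0 + signSum (fun n => a n.succ) s := by
      intro e s
      simp [signSum, Fin.sum_univ_succ, Fin.consEquiv]
    simp only [h, Units.val_one, one_smul, Units.val_neg, neg_smul]
    -- Pairing the two values of the first sign removes the cross terms by the parallelogram law.
    have h2 : ∀ s : Fin N → ℤˣ, ‖a 0 + signSum (fun n => a n.succ) s‖ ^ 2 +
        ‖-a 0 + signSum (fun n => a n.succ) s‖ ^ 2 =
        2 * ‖a 0‖ ^ 2 + 2 * ‖signSum (fun n => a n.succ) s‖ ^ 2 := by
      intro s
      have := parallelogram_law_with_norm ℝ (signSum (fun n => a n.succ) s) (a 0)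
      rw [neg_add_eq_sub, add_comm (a 0)]
      nlinarith
    simp only [h2, Finset.sum_add_distrib, ← Finset.mul_sum, ih, Finset.sum_const,
      Finset.card_univ, card_signs, Fin.sum_univ_succ]
    simp only [nsmul_eq_mul]
    push_cast
    ring

/-- Khintchine's inequality, lower bound. -/
theorem exists_le_sum_norm_signSum_rpow (p : ℝ) (hp : 0 < p) (hp2 : p ≤ 2) :
    ∃ C : ℝ, 0 < C ∧ ∀ (N : ℕ) (a : Fin N → ℂ),
      2 ^ N * (∑ n, ‖a n‖ ^ 2) ^ (p / 2) ≤ C * ∑ s, ‖signSum a s‖ ^ p := by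
  obtain ⟨C, hC, h⟩ := exists_sum_norm_signSum_rpow_le 4 (by norm_num)
  -- `B` is chosen so that, in x² ≤ B x^p + x⁴/B, the fourth moments absorb at most half of the
  -- second moment, which after normalization is exactly 2 ^ N.
  set B := max 1 (2 * C)
  have hB1 : 1 ≤ B := le_max_left _ _
  have hB2 : 2 * C ≤ B := le_max_right _ _
  have hB0 : 0 < B := by linarith
  refine ⟨2 * B, by positivity, fun N a => ?_⟩
  by_cases h0 : ∑ n, ‖a n‖ ^ 2 = 0
  · rw [h0, Real.zero_rpow (by positivity), mul_zero]
    positivity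
  obtain ⟨σ, b, hσ, ha, hb, hab⟩ := exists_normalized a h0
  have hpt : ∀ x : ℝ, 0 ≤ x → x ^ 2 ≤ B * x ^ p + x ^ (4 : ℝ) / B := by
    intro x hx
    rw [show (4 : ℝ) = (4 : ℕ) by norm_num, Real.rpow_natCast]
    rcases le_total (x ^ 2) B with hle | hle
    · have h1 : x ^ 2 = x ^ (2 - p) * x ^ p := by
        rcases hx.eq_or_lt with rfl | hx
        · simp [Real.zero_rpow hp.ne']
        · rw [← Real.rpow_add hx, sub_add_cancel]; norm_num
      have h2 : x ^ (2 - p) ≤ B := by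
        rcases le_total x 1 with h3 | h3
        · exact (Real.rpow_le_one hx h3 (by linarith)).trans hB1
        · refine le_trans ?_ hle
          rw [← Real.rpow_natCast]
          exact Real.rpow_le_rpow_of_exponent_le h3 (by push_cast; linarith)
      have h3 : 0 ≤ x ^ 4 / B := by positivity
      have h4 : 0 ≤ x ^ p := Real.rpow_nonneg hx p
      nlinarith
    · have h1 : x ^ 2 ≤ x ^ 4 / B := by
        rw [le_div_iff₀ hB0]
        nlinarith [sq_nonneg x]
      have h4 : 0 ≤ x ^ p := Real.rpow_nonneg hx p
      nlinarith
  have h4 := h N b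
  rw [hb, Real.one_rpow, mul_one] at h4
  have h1 : (2 : ℝ) ^ N ≤ B * ∑ s, ‖signSum b s‖ ^ p + C * 2 ^ N / B := by
    calc (2 : ℝ) ^ N = ∑ s, ‖signSum b s‖ ^ 2 := by rw [sum_norm_signSum_sq, hb, mul_one]
      _ ≤ ∑ s, (B * ‖signSum b s‖ ^ p + ‖signSum b s‖ ^ (4 : ℝ) / B) :=
          Finset.sum_le_sum fun s _ => hpt _ (norm_nonneg _)
      _ = B * ∑ s, ‖signSum b s‖ ^ p + (∑ s, ‖signSum b s‖ ^ (4 : ℝ)) / B := by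
          rw [Finset.sum_add_distrib, Finset.mul_sum, Finset.sum_div]
      _ ≤ _ := by gcongr
  have h2 : C * 2 ^ N / B ≤ 2 ^ N / 2 := by
    rw [div_le_div_iff₀ hB0 two_pos]
    have : (0 : ℝ) < 2 ^ N := by positivity
    nlinarith
  have h3 : (2 : ℝ) ^ N ≤ 2 * B * ∑ s, ‖signSum b s‖ ^ p := by linarith
  have h5 : (σ ^ 2) ^ (p / 2) = σ ^ p := by
    rw [← Real.rpow_natCast, ← Real.rpow_mul hσ.le]; congr 1; push_cast; ring
  rw [ha, h5]
  simp only [hab, Real.mul_rpow hσ.le (norm_nonneg _), ← Finset.mul_sum]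
  calc 2 ^ N * σ ^ p ≤ (2 * B * ∑ s, ‖signSum b s‖ ^ p) * σ ^ p := by gcongr
    _ = _ := by ring

theorem ofReal_sum_norm_rpow {ι F : Type*} [SeminormedAddCommGroup F] (t : Finset ι) (f : ι → F)
    {q : ℝ} (hq : 0 ≤ q) : ENNReal.ofReal (∑ i ∈ t, ‖f i‖ ^ q) = ∑ i ∈ t, ‖f i‖ₑ ^ q := by
  rw [ENNReal.ofReal_sum_of_nonneg fun i _ => by positivity]
  refine Finset.sum_congr rfl fun i _ => ?_
  rw [← ENNReal.ofReal_rpow_of_nonneg (norm_nonneg _) hq, ofReal_norm]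

theorem ofReal_sum_norm_sq {ι F : Type*} [SeminormedAddCommGroup F] (t : Finset ι) (f : ι → F) :
    ENNReal.ofReal (∑ i ∈ t, ‖f i‖ ^ 2) = ∑ i ∈ t, ‖f i‖ₑ ^ 2 := by
  rw [ENNReal.ofReal_sum_of_nonneg fun i _ => by positivity]
  refine Finset.sum_congr rfl fun i _ => ?_
  rw [ENNReal.ofReal_pow (norm_nonneg _), ofReal_norm]

theorem exists_sum_enorm_signSum_rpow_le (q : ℝ) (hq : 0 < q) :
    ∃ C : ℝ≥0∞, C ≠ ⊤ ∧ ∀ (N : ℕ) (a : Fin N → ℂ),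
      ∑ s, ‖signSum a s‖ₑ ^ q ≤ C * 2 ^ N * (∑ n, ‖a n‖ₑ ^ 2) ^ (q / 2) := by
  obtain ⟨C, hC, h⟩ := exists_sum_norm_signSum_rpow_le q hq
  refine ⟨ENNReal.ofReal C, ENNReal.ofReal_ne_top, fun N a => ?_⟩
  have := ENNReal.ofReal_le_ofReal (h N a)
  rwa [ofReal_sum_norm_rpow _ _ hq.le, ENNReal.ofReal_mul (by positivity),
    ENNReal.ofReal_mul hC.le, ENNReal.ofReal_pow (by norm_num), ENNReal.ofReal_ofNat,
    ← ENNReal.ofReal_rpow_of_nonneg (by positivity) (by positivity), ofReal_sum_norm_sq] at this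

theorem sum_enorm_signSum_sq {N : ℕ} (a : Fin N → ℂ) :
    ∑ s, ‖signSum a s‖ₑ ^ 2 = 2 ^ N * ∑ n, ‖a n‖ₑ ^ 2 := by
  rw [← ofReal_sum_norm_sq, sum_norm_signSum_sq, ENNReal.ofReal_mul (by positivity),
    ENNReal.ofReal_pow (by norm_num), ENNReal.ofReal_ofNat, ofReal_sum_norm_sq]

theorem exists_le_sum_enorm_signSum_rpow (p : ℝ) (hp : 0 < p) (hp2 : p ≤ 2) :
    ∃ C : ℝ≥0∞, C ≠ ⊤ ∧ ∀ (N : ℕ) (a : Fin N → ℂ),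
      2 ^ N * (∑ n, ‖a n‖ₑ ^ 2) ^ (p / 2) ≤ C * ∑ s, ‖signSum a s‖ₑ ^ p := by
  obtain ⟨C, hC, h⟩ := exists_le_sum_norm_signSum_rpow p hp hp2
  refine ⟨ENNReal.ofReal C, ENNReal.ofReal_ne_top, fun N a => ?_⟩
  have := ENNReal.ofReal_le_ofReal (h N a)
  rwa [ENNReal.ofReal_mul hC.le, ofReal_sum_norm_rpow _ _ hp.le, ENNReal.ofReal_mul (by positivity),
    ENNReal.ofReal_pow (by norm_num), ENNReal.ofReal_ofNat,
    ← ENNReal.ofReal_rpow_of_nonneg (by positivity) (by positivity), ofReal_sum_norm_sq] at this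

end Khintchine

/-! ### Rademacher averages in `L^p` and square functions -/

section SquareFunction

variable {α ι : Type*} [MeasurableSpace α] {μ : Measure α}

/-- Minkowski's inequality for finite sums. -/
theorem lintegral_sum_rpow_le (t : Finset ι) {f : ι → α → ℝ≥0∞}
    (hf : ∀ i, AEMeasurable (f i) μ) {r : ℝ} (hr : 1 ≤ r) :
    (∫⁻ x, (∑ i ∈ t, f i x) ^ r ∂μ) ^ (1 / r) ≤ ∑ i ∈ t, (∫⁻ x, f i x ^ r ∂μ) ^ (1 / r) := by
  classical
  have hr0 : 0 < r := by linarith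
  induction t using Finset.induction_on with
  | empty => simp [hr0]
  | insert i t hi ih =>
    simp only [Finset.sum_insert hi]
    refine (ENNReal.lintegral_Lp_add_le (hf i)
      (Finset.aemeasurable_fun_sum t fun j _ => hf j) hr).trans ?_
    gcongr

/-- Minkowski's integral inequality with a finite outer sum. -/
theorem sum_lintegral_rpow_le (t : Finset ι) {f : ι → α → ℝ≥0∞}
    (hf : ∀ i, AEMeasurable (f i) μ) (hfin : ∀ i, ∫⁻ x, f i x ∂μ ≠ ⊤) {r : ℝ} (hr : 1 < r) :
    ∑ i ∈ t, (∫⁻ x, f i x ∂μ) ^ r ≤ (∫⁻ x, (∑ i ∈ t, f i x ^ r) ^ (1 / r) ∂μ) ^ r := by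
  have hst := Real.HolderConjugate.conjExponent hr
  set q := r.conjExponent
  have hX : ∑ i ∈ t, (∫⁻ x, f i x ∂μ) ^ r ≠ ⊤ :=
    ENNReal.sum_ne_top.2 fun i _ => ENNReal.rpow_ne_top_of_nonneg hst.nonneg (hfin i)
  refine le_rpow_of_le_mul_rpow hX hst ?_
  set I := fun i => ∫⁻ x, f i x ∂μ
  have hI : ∀ i, I i ^ (r - 1) ≠ ⊤ := fun i =>
    ENNReal.rpow_ne_top_of_nonneg (by linarith) (hfin i)
  -- One factor of each power is written as an integral, Hölder is applied to the finite sum under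
  -- the integral, and the resulting power of the left side is absorbed.
  calc ∑ i ∈ t, I i ^ r = ∑ i ∈ t, ∫⁻ x, f i x * I i ^ (r - 1) ∂μ := by
        refine Finset.sum_congr rfl fun i _ => ?_
        rw [lintegral_mul_const' _ _ (hI i)]
        conv_lhs => rw [show r = 1 + (r - 1) by ring,
          ENNReal.rpow_add_of_nonneg _ _ zero_le_one (by linarith), ENNReal.rpow_one]
    _ = ∫⁻ x, ∑ i ∈ t, f i x * I i ^ (r - 1) ∂μ :=
        (lintegral_finsetSum' _ fun i _ => (hf i).mul_const _).symm
    _ ≤ ∫⁻ x, (∑ i ∈ t, f i x ^ r) ^ (1 / r) * (∑ i ∈ t, I i ^ r) ^ (1 / q) ∂μ := by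
        refine lintegral_mono fun x => ?_
        refine (ENNReal.inner_le_Lp_mul_Lq t _ _ hst).trans_eq ?_
        simp_rw [← ENNReal.rpow_mul, hst.sub_one_mul_conj]
    _ = _ := lintegral_mul_const' _ _ (ENNReal.rpow_ne_top_of_nonneg
        (by have := hst.symm.pos; positivity) hX)

variable {p : ℝ≥0∞} [Fact (1 ≤ p)]

omit [Fact (1 ≤ p)] in
theorem coeFn_signSum {N : ℕ} (f : Fin N → Lp ℂ p μ) (s : Fin N → ℤˣ) :
    (signSum f s : Lp ℂ p μ) =ᵐ[μ] fun x => signSum (fun n => f n x) s := by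
  have h : ∀ n, ((s n : ℤ) • f n : Lp ℂ p μ) =ᵐ[μ] fun x => (s n : ℤ) • f n x := by
    intro n
    rcases Int.units_eq_one_or (s n) with h | h
    · simp only [h, Units.val_one, one_smul]; rfl
    · simp only [h, Units.val_neg, Units.val_one, neg_smul, one_smul]
      exact Lp.coeFn_neg _
  refine (Lp.coeFn_finsetSum _ _).trans ?_
  have := ae_all_iff.2 h
  filter_upwards [this] with x hx
  simp only [Finset.sum_apply, signSum, hx]

theorem enorm_rpow_eq_lintegral (hp0 : p ≠ 0) (hp : p ≠ ⊤) (f : Lp ℂ p μ) :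
    ‖f‖ₑ ^ p.toReal = ∫⁻ x, ‖f x‖ₑ ^ p.toReal ∂μ := by
  rw [Lp.enorm_def, eLpNorm_eq_lintegral_rpow_enorm_toReal hp0 hp, ← ENNReal.rpow_mul,
    one_div_mul_cancel (ENNReal.toReal_pos hp0 hp).ne', ENNReal.rpow_one]

/-- The `p`-th power of the `L^p` norm of the square function `(∑ₙ |fₙ|²)^{1/2}`. -/
def squareIntegral {N : ℕ} (f : Fin N → Lp ℂ p μ) : ℝ≥0∞ :=
  ∫⁻ x, (∑ n, ‖f n x‖ₑ ^ 2) ^ (p.toReal / 2) ∂μ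

theorem sum_enorm_signSum_rpow_eq (hp0 : p ≠ 0) (hp : p ≠ ⊤) {N : ℕ} (f : Fin N → Lp ℂ p μ) :
    ∑ s, ‖signSum f s‖ₑ ^ p.toReal =
      ∫⁻ x, ∑ s, ‖signSum (fun n => f n x) s‖ₑ ^ p.toReal ∂μ := by
  rw [lintegral_finsetSum']
  · refine Finset.sum_congr rfl fun s _ => ?_
    rw [enorm_rpow_eq_lintegral hp0 hp]
    refine lintegral_congr_ae ((coeFn_signSum f s).mono fun x hx => ?_)
    simp only [hx]
  · intro s _
    refine AEMeasurable.pow_const ?_ _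
    exact ((Lp.aestronglyMeasurable _).congr (coeFn_signSum f s)).enorm

theorem rpow_sum_signs_le {N : ℕ} (b : (Fin N → ℤˣ) → ℝ≥0∞) {r : ℝ} (hr : 1 ≤ r) :
    (∑ s, b s) ^ r ≤ (2 ^ N) ^ (r - 1) * ∑ s, b s ^ r := by
  have := ENNReal.rpow_sum_le_const_mul_sum_rpow Finset.univ b hr
  rwa [Finset.card_univ, card_signs, Nat.cast_pow, Nat.cast_ofNat] at this

theorem sq_rpow_half (a : ℝ≥0∞) (q : ℝ) : (a ^ 2) ^ (q / 2) = a ^ q := by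
  rw [← ENNReal.rpow_natCast, ← ENNReal.rpow_mul]; congr 1; push_cast; ring

theorem rpow_rpow_two_div (a : ℝ≥0∞) {q : ℝ} (hq : q ≠ 0) : (a ^ q) ^ (2 / q) = a ^ 2 := by
  rw [← ENNReal.rpow_mul, mul_div_cancel₀ _ hq, ENNReal.rpow_ofNat]

/-- The Rademacher average is bounded by the square function. -/
theorem exists_signSum_le_squareIntegral (hp1 : 1 < p) (hp : p ≠ ⊤) :
    ∃ C : ℝ≥0∞, C ≠ ⊤ ∧ ∀ (N : ℕ) (f : Fin N → Lp ℂ p μ),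
      (∑ s, ‖signSum f s‖ₑ ^ 2) ^ (p.toReal / 2) ≤
        C * (2 ^ N) ^ (p.toReal / 2) * squareIntegral f := by
  have hp0 : p ≠ 0 := (zero_lt_one.trans hp1).ne'
  set q := p.toReal
  have hq1 : 1 < q := by
    rw [← ENNReal.toReal_one]; exact ENNReal.toReal_strict_mono hp hp1
  rcases le_or_gt 2 q with hq2 | hq2
  -- For q ≥ 2: power means replace second moments by q-th moments, which Khintchine bounds
  -- pointwise.
  · obtain ⟨C, hC, h⟩ := exists_sum_enorm_signSum_rpow_le q (by linarith)
    refine ⟨C, hC, fun N f => ?_⟩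
    refine (rpow_sum_signs_le _ (by linarith)).trans ?_
    simp only [sq_rpow_half]
    rw [sum_enorm_signSum_rpow_eq hp0 hp]
    have h2 : (2 : ℝ≥0∞) ^ N ≠ 0 := by positivity
    have h2' : (2 : ℝ≥0∞) ^ N ≠ ⊤ := by finiteness
    calc (2 ^ N) ^ (q / 2 - 1) * ∫⁻ x, ∑ s, ‖signSum (fun n => f n x) s‖ₑ ^ q ∂μ
        ≤ (2 ^ N) ^ (q / 2 - 1) * ∫⁻ x, C * 2 ^ N * (∑ n, ‖f n x‖ₑ ^ 2) ^ (q / 2) ∂μ := by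
          gcongr; exact h N _
      _ = (2 ^ N) ^ (q / 2 - 1) * (C * 2 ^ N * squareIntegral f) := by
          rw [lintegral_const_mul' _ _ (by finiteness)]; rfl
      _ = C * ((2 ^ N) ^ (q / 2 - 1) * 2 ^ N) * squareIntegral f := by ring
      _ = _ := by
          conv_lhs => enter [1, 2, 2]; rw [← ENNReal.rpow_one (2 ^ N)]
          rw [← ENNReal.rpow_add _ _ h2 h2', sub_add_cancel]
  -- For q < 2: Minkowski with exponent 2/q > 1, after which the pointwise second moment is known
  -- exactly; constant 1.
  · refine ⟨1, by simp, fun N f => ?_⟩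
    have hr : 1 < 2 / q := by rw [lt_div_iff₀ (by linarith)]; linarith
    have hm : ∀ s, AEMeasurable (fun x => ‖signSum (fun n => f n x) s‖ₑ ^ q) μ := fun s =>
      (((Lp.aestronglyMeasurable _).congr (coeFn_signSum f s)).enorm).pow_const _
    have he : ∀ s, ∫⁻ x, ‖signSum (fun n => f n x) s‖ₑ ^ q ∂μ = ‖signSum f s‖ₑ ^ q := by
      intro s
      rw [enorm_rpow_eq_lintegral hp0 hp]
      exact lintegral_congr_ae ((coeFn_signSum f s).mono fun x hx => by simp only [hx, q])
    have h := sum_lintegral_rpow_le (μ := μ) Finset.univ hm (fun s => by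
      rw [he]; exact ENNReal.rpow_ne_top_of_nonneg (by linarith) enorm_ne_top) hr
    simp only [he, rpow_rpow_two_div _ (show q ≠ 0 by linarith), sum_enorm_signSum_sq] at h
    have hq : 1 / (2 / q) = q / 2 := by rw [one_div_div]
    rw [hq] at h
    calc (∑ s, ‖signSum f s‖ₑ ^ 2) ^ (q / 2)
        ≤ ((∫⁻ x, (2 ^ N * ∑ n, ‖f n x‖ₑ ^ 2) ^ (q / 2) ∂μ) ^ (2 / q)) ^ (q / 2) := by gcongr
      _ = ∫⁻ x, (2 ^ N) ^ (q / 2) * (∑ n, ‖f n x‖ₑ ^ 2) ^ (q / 2) ∂μ := by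
          rw [← ENNReal.rpow_mul, show 2 / q * (q / 2) = 1 by
            have : q ≠ 0 := by linarith
            field_simp, ENNReal.rpow_one]
          exact lintegral_congr fun x => ENNReal.mul_rpow_of_nonneg _ _ (by linarith)
      _ = _ := by
          rw [lintegral_const_mul' _ _ (ENNReal.rpow_ne_top_of_nonneg (by linarith)
            (by finiteness)), one_mul]
          rfl

/-- The square function is bounded by the Rademacher average. -/
theorem exists_squareIntegral_le_signSum (hp1 : 1 < p) (hp : p ≠ ⊤) :
    ∃ C : ℝ≥0∞, C ≠ ⊤ ∧ ∀ (N : ℕ) (f : Fin N → Lp ℂ p μ),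
      (2 ^ N) ^ (p.toReal / 2) * squareIntegral f ≤
        C * (∑ s, ‖signSum f s‖ₑ ^ 2) ^ (p.toReal / 2) := by
  have hp0 : p ≠ 0 := (zero_lt_one.trans hp1).ne'
  set q := p.toReal
  have hq1 : 1 < q := by
    rw [← ENNReal.toReal_one]; exact ENNReal.toReal_strict_mono hp hp1
  rcases le_or_gt q 2 with hq2 | hq2
  -- For q ≤ 2: the pointwise Khintchine lower bound, then power means from q-th to second moments.
  · obtain ⟨C, hC, h⟩ := exists_le_sum_enorm_signSum_rpow q (by linarith) hq2
    refine ⟨C, hC, fun N f => ?_⟩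
    have h2 : (2 : ℝ≥0∞) ^ N ≠ 0 := by positivity
    have h2' : (2 : ℝ≥0∞) ^ N ≠ ⊤ := by finiteness
    have h1 : 2 ^ N * squareIntegral f ≤ C * ∑ s, ‖signSum f s‖ₑ ^ q := by
      rw [sum_enorm_signSum_rpow_eq hp0 hp, ← lintegral_const_mul' _ _ hC, squareIntegral,
        ← lintegral_const_mul' _ _ h2']
      exact lintegral_mono fun x => h N _
    have h3 : ∑ s, ‖signSum f s‖ₑ ^ q ≤
        (2 ^ N) ^ (1 - q / 2) * (∑ s, ‖signSum f s‖ₑ ^ 2) ^ (q / 2) := by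
      have h4 := rpow_sum_signs_le (fun s => ‖signSum f s‖ₑ ^ q) (r := 2 / q)
        (by rw [le_div_iff₀ (by linarith)]; linarith)
      simp only [rpow_rpow_two_div _ (show q ≠ 0 by linarith)] at h4
      have h5 := ENNReal.rpow_le_rpow h4 (show 0 ≤ q / 2 by linarith)
      have hqq : q ≠ 0 := by linarith
      rwa [← ENNReal.rpow_mul, show 2 / q * (q / 2) = 1 by field_simp, ENNReal.rpow_one,
        ENNReal.mul_rpow_of_nonneg _ _ (by linarith), ← ENNReal.rpow_mul,
        show (2 / q - 1) * (q / 2) = 1 - q / 2 by field_simp] at h5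
    calc (2 ^ N) ^ (q / 2) * squareIntegral f
        = (2 ^ N) ^ (q / 2 - 1) * (2 ^ N * squareIntegral f) := by
          rw [← mul_assoc]
          congr 1
          conv_rhs => enter [2]; rw [← ENNReal.rpow_one (2 ^ N)]
          rw [← ENNReal.rpow_add _ _ h2 h2', sub_add_cancel]
      _ ≤ (2 ^ N) ^ (q / 2 - 1) * (C * ((2 ^ N) ^ (1 - q / 2) *
            (∑ s, ‖signSum f s‖ₑ ^ 2) ^ (q / 2))) := by
          exact mul_le_mul_right (h1.trans (mul_le_mul_right h3 _)) _
      _ = C * ((2 ^ N) ^ (q / 2 - 1) * (2 ^ N) ^ (1 - q / 2)) *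
            (∑ s, ‖signSum f s‖ₑ ^ 2) ^ (q / 2) := by ring
      _ = _ := by
          rw [← ENNReal.rpow_add _ _ h2 h2', show q / 2 - 1 + (1 - q / 2) = 0 by ring,
            ENNReal.rpow_zero, mul_one]
  -- For q > 2: the triangle inequality in L^{q/2} applied to the squared moduli, and orthogonality
  -- of signs.
  · refine ⟨1, by simp, fun N f => ?_⟩
    have hm : ∀ s, AEMeasurable (fun x => ‖signSum (fun n => f n x) s‖ₑ ^ 2) μ := fun s =>
      (((Lp.aestronglyMeasurable _).congr (coeFn_signSum f s)).enorm).pow_const _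
    have he : ∀ s, (∫⁻ x, (‖signSum (fun n => f n x) s‖ₑ ^ 2) ^ (q / 2) ∂μ) ^ (1 / (q / 2)) =
        ‖signSum f s‖ₑ ^ 2 := by
      intro s
      simp only [sq_rpow_half]
      rw [one_div_div, ← rpow_rpow_two_div ‖signSum f s‖ₑ (show q ≠ 0 by linarith),
        enorm_rpow_eq_lintegral hp0 hp]
      congr 1
      exact lintegral_congr_ae ((coeFn_signSum f s).mono fun x hx => by simp only [hx, q])
    have h := lintegral_sum_rpow_le (μ := μ) Finset.univ hm (show 1 ≤ q / 2 by linarith)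
    simp only [he, sum_enorm_signSum_sq] at h
    have h5 := ENNReal.rpow_le_rpow h (show 0 ≤ q / 2 by linarith)
    rw [← ENNReal.rpow_mul, one_div_mul_cancel (by linarith), ENNReal.rpow_one] at h5
    rw [one_mul]
    refine le_trans (le_of_eq ?_) h5
    rw [squareIntegral, ← lintegral_const_mul' _ _ (ENNReal.rpow_ne_top_of_nonneg (by linarith)
      (by finiteness))]
    exact lintegral_congr fun x => (ENNReal.mul_rpow_of_nonneg _ _ (by linarith)).symm

theorem ofReal_rademacherNorm_sq {X : Type*} [NormedAddCommGroup X] {N : ℕ} (x : Fin N → X) :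
    ENNReal.ofReal (rademacherNorm x ^ 2) * 2 ^ N = ∑ s, ‖signSum x s‖ₑ ^ 2 := by
  rw [rademacherNorm, Real.sq_sqrt (by positivity), ← ofReal_sum_norm_sq]
  have : (2 : ℝ≥0∞) ^ N = ENNReal.ofReal (2 ^ N) := by
    rw [ENNReal.ofReal_pow (by norm_num), ENNReal.ofReal_ofNat]
  rw [this, ← ENNReal.ofReal_mul (by positivity), div_mul_cancel₀ _ (by positivity)]
  rfl

/-- A family of operators on `L^p` that satisfies a square function estimate is R-bounded. -/
theorem rBounded_of_squareIntegral_le (hp1 : 1 < p) (hp : p ≠ ⊤)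
    (𝒯 : Set (Lp ℂ p μ →L[ℂ] Lp ℂ p μ)) {C : ℝ≥0∞} (hC : C ≠ ⊤)
    (h : ∀ (N : ℕ) (T : Fin N → Lp ℂ p μ →L[ℂ] Lp ℂ p μ) (f : Fin N → Lp ℂ p μ),
      (∀ n, T n ∈ 𝒯) → squareIntegral (fun n => T n (f n)) ≤ C * squareIntegral f) :
    RBounded 𝒯 := by
  obtain ⟨C₁, hC₁, h₁⟩ := exists_signSum_le_squareIntegral (μ := μ) hp1 hp
  obtain ⟨C₂, hC₂, h₂⟩ := exists_squareIntegral_le_signSum (μ := μ) hp1 hp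
  set q := p.toReal
  have hq : 0 < q := ENNReal.toReal_pos (zero_lt_one.trans hp1).ne' hp
  set D := (C₁ * C * C₂) ^ (2 / q)
  have hD : D ≠ ⊤ := ENNReal.rpow_ne_top_of_nonneg (by positivity) (by finiteness)
  refine ⟨Real.sqrt D.toReal, Real.sqrt_nonneg _, fun N T f hT => ?_⟩
  set g := fun n => T n (f n)
  have h3 : (∑ s, ‖signSum g s‖ₑ ^ 2) ^ (q / 2) ≤
      (C₁ * C * C₂) * (∑ s, ‖signSum f s‖ₑ ^ 2) ^ (q / 2) := by
    calc _ ≤ C₁ * (2 ^ N) ^ (q / 2) * squareIntegral g := h₁ N g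
      _ ≤ C₁ * (2 ^ N) ^ (q / 2) * (C * squareIntegral f) := by gcongr; exact h N T f hT
      _ = C₁ * C * ((2 ^ N) ^ (q / 2) * squareIntegral f) := by ring
      _ ≤ C₁ * C * (C₂ * (∑ s, ‖signSum f s‖ₑ ^ 2) ^ (q / 2)) :=
          mul_le_mul_right (h₂ N f) _
      _ = _ := by ring
  have h4 : ∑ s, ‖signSum g s‖ₑ ^ 2 ≤ D * ∑ s, ‖signSum f s‖ₑ ^ 2 := by
    have h5 := ENNReal.rpow_le_rpow h3 (show 0 ≤ 2 / q by positivity)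
    have e : q / 2 * (2 / q) = 1 := by field_simp
    rwa [ENNReal.mul_rpow_of_nonneg _ _ (by positivity), ← ENNReal.rpow_mul, ← ENNReal.rpow_mul, e,
      ENNReal.rpow_one, ENNReal.rpow_one] at h5
  rw [← ofReal_rademacherNorm_sq, ← ofReal_rademacherNorm_sq, ← mul_assoc] at h4
  have h6 := (ENNReal.mul_le_mul_iff_left (show (2 : ℝ≥0∞) ^ N ≠ 0 by positivity)
    (by finiteness)).1 h4
  rw [← ENNReal.ofReal_toReal hD, ← ENNReal.ofReal_mul ENNReal.toReal_nonneg,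
    ENNReal.ofReal_le_ofReal_iff (by positivity)] at h6
  refine abs_le_of_sq_le_sq' ?_ (by unfold rademacherNorm; positivity) |>.2
  rwa [mul_pow, Real.sq_sqrt ENNReal.toReal_nonneg]

end SquareFunction

/-! ### The sum `HS₀(M) ⊕ B` is direct -/

section DirectSum

open scoped FourierTransform SchwartzMap

variable {d : ℕ}

theorem fourierInt_eq_fourier (ψ : E d → ℂ) (k : E d) :
    fourierInt ψ k =
      (((2 * Real.pi) ^ (-(d : ℝ) / 2) : ℝ) : ℂ) * 𝓕 ψ ((2 * Real.pi)⁻¹ • k) := by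
  rw [fourierInt, Real.fourier_eq']
  congr 2
  ext ξ
  rw [smul_eq_mul, mul_comm]
  congr 2
  rw [real_inner_smul_right, real_inner_comm]
  push_cast
  have : (Real.pi : ℂ) ≠ 0 := by exact_mod_cast Real.pi_ne_zero
  field_simp

theorem integrable_fourierInt (ψ : 𝓢(E d, ℂ)) : Integrable (fourierInt ψ) := by
  have h : Integrable fun k : E d => 𝓕 (ψ : E d → ℂ) ((2 * Real.pi)⁻¹ • k) := by
    rw [← SchwartzMap.fourier_coe]
    exact (𝓕 ψ).integrable.comp_smul (by positivity)
  exact (h.const_mul _).congr (.of_forall fun k => (fourierInt_eq_fourier ψ k).symm)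

/-- Fourier inversion at the origin; equivalently, the Fourier transform of the constant 1 is
(2π)^{d/2} times the Dirac mass. The constant reflects the rescaling by 2π between the two
normalizations. -/
theorem integral_fourierInt (ψ : 𝓢(E d, ℂ)) :
    ∫ k, fourierInt ψ k = (((2 * Real.pi) ^ ((d : ℝ) / 2) : ℝ) : ℂ) * ψ 0 := by
  have h0 : ∫ k : E d, 𝓕 (ψ : E d → ℂ) k = ψ 0 := by
    have h1 : 𝓕⁻ (𝓕 ψ) = ψ := FourierTransform.fourierInv_fourier_eq ψ
    have h2 : (𝓕⁻ (𝓕 ψ)) 0 = ψ 0 := by rw [h1]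
    rw [SchwartzMap.fourierInv_coe, SchwartzMap.fourier_coe, Real.fourierInv_eq'] at h2
    simpa using h2
  have hpi : (0 : ℝ) < 2 * Real.pi := by positivity
  simp only [fourierInt_eq_fourier]
  rw [integral_const_mul, Measure.integral_comp_inv_smul_of_nonneg _ _ hpi.le, h0,
    finrank_euclideanSpace_fin, Complex.real_smul, ← mul_assoc, ← Complex.ofReal_mul,
    ← Real.rpow_natCast, ← Real.rpow_add hpi]
  congr 4
  ring

/-- An integrable function does not act on test functions as a multiple of the Dirac mass. -/
theorem eq_zero_of_integral_eq_eval [Nontrivial (E d)] {H : E d → ℂ} (hH : Integrable H) {z : ℂ}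
    (h : ∀ ψ : 𝓢(E d, ℂ), ∫ k, H k * ψ k = z * ψ 0) : z = 0 := by
  let bump : ℕ → ContDiffBump (0 : E d) := fun n =>
    { rIn := 1 / ((n : ℝ) + 2)
      rOut := 1 / ((n : ℝ) + 1)
      rIn_pos := by positivity
      rIn_lt_rOut := by
        apply one_div_lt_one_div_of_lt <;> [positivity; linarith] }
  have hcs : ∀ n, HasCompactSupport fun x => ((bump n x : ℝ) : ℂ) := fun n =>
    (bump n).hasCompactSupport.comp_left (g := fun t : ℝ => (t : ℂ)) rfl
  have hcd : ∀ n, ContDiff ℝ ∞ fun x => ((bump n x : ℝ) : ℂ) := fun n =>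
    Complex.ofRealCLM.contDiff.comp (bump n).contDiff
  -- Every bump equals 1 at the origin, so the pairing stays at `z`, while the shrinking supports
  -- force it to 0 by dominated convergence.
  have hz : ∀ n, ∫ k, H k * ((bump n k : ℝ) : ℂ) = z := by
    intro n
    have h1 := h ((hcs n).toSchwartzMap (hcd n))
    simp only [HasCompactSupport.toSchwartzMap_toFun] at h1
    refine h1.trans ?_
    have : bump n 0 = 1 := (bump n).one_of_mem_closedBall
      (Metric.mem_closedBall_self (bump n).rIn_pos.le)
    simp [this]
  have hlim : Filter.Tendsto (fun n => ∫ k, H k * ((bump n k : ℝ) : ℂ)) Filter.atTop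
      (nhds (∫ _ : E d, (0 : ℂ))) := by
    refine tendsto_integral_of_dominated_convergence (fun k => ‖H k‖) ?_ hH.norm ?_ ?_
    · exact fun n => hH.aestronglyMeasurable.mul (hcd n).continuous.aestronglyMeasurable
    · refine fun n => .of_forall fun k => ?_
      rw [norm_mul, Complex.norm_real, Real.norm_eq_abs, abs_of_nonneg (bump n).nonneg]
      exact mul_le_of_le_one_right (norm_nonneg _) (bump n).le_one
    · have h0 : ∀ᵐ k : E d, k ≠ 0 := by simp [ae_iff]
      filter_upwards [h0] with k hk
      refine tendsto_const_nhds.congr' ?_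
      obtain ⟨n₀, hn₀⟩ := exists_nat_one_div_lt (norm_pos_iff.2 hk)
      filter_upwards [Filter.eventually_ge_atTop n₀] with n hn
      have : bump n k = 0 := by
        refine (bump n).zero_of_le_dist ?_
        rw [dist_zero_right]
        refine le_trans ?_ hn₀.le
        exact one_div_le_one_div_of_le (by positivity) (by gcongr)
      simp [this]
  simp only [hz, integral_zero] at hlim
  exact tendsto_nhds_unique tendsto_const_nhds hlim

theorem stronglyMeasurable_partialFourier {M : E d → E d} (hM : Measurable M)
    (g : E d × E d →ₘ[volume] ℂ) :
    StronglyMeasurable fun z : E d × E d => partialFourier M g z.1 z.2 := by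
  have h1 : Measurable fun z : E d × E d =>
      (Real.exp (-|(inner ℝ (M z.1) z.2 : ℝ)|) : ℂ) := by fun_prop
  exact (h1.stronglyMeasurable.const_mul _).mul g.stronglyMeasurable

theorem ae_integrable_partialFourier {M : E d → E d} (hM : Measurable M)
    {g : E d × E d →ₘ[volume] ℂ} (hg : g ∈ DInfOne d) :
    ∀ᵐ x : E d, Integrable fun k => partialFourier M g x k := by
  obtain ⟨G, hG, h⟩ := hg
  filter_upwards [Measure.ae_ae_of_ae_prod h] with x hx
  refine (hG.const_mul ((2 * Real.pi) ^ ((d : ℝ) / 2))).mono' ?_ ?_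
  · exact ((stronglyMeasurable_partialFourier hM g).comp_measurable
      measurable_prodMk_left).aestronglyMeasurable
  · filter_upwards [hx] with k hk
    have hpos : (0 : ℝ) ≤ (2 * Real.pi) ^ ((d : ℝ) / 2) := by positivity
    rw [partialFourier, norm_mul, norm_mul, Complex.norm_real, Complex.norm_real,
      Real.norm_of_nonneg hpos, Real.norm_of_nonneg (Real.exp_pos _).le]
    have h1 : Real.exp (-|(inner ℝ (M x) k : ℝ)|) ≤ 1 := by
      rw [Real.exp_le_one_iff]; simp
    calc (2 * Real.pi) ^ ((d : ℝ) / 2) * Real.exp (-|(inner ℝ (M x) k : ℝ)|) * ‖g (x, k)‖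
        ≤ (2 * Real.pi) ^ ((d : ℝ) / 2) * 1 * G k := by gcongr
      _ = _ := by rw [mul_one]

/-- Almost every slice is essentially bounded. The exceptional set must not depend on `F`, since all
Schwartz functions are tested on one slice. -/
theorem ae_integrable_mul_of_linf (a : Linf d) :
    ∀ᵐ x : E d, ∀ F : E d → ℂ, Integrable F → Integrable fun ξ => a (x, ξ) * F ξ := by
  have h := ae_le_eLpNormEssSup (f := a) (μ := (volume : Measure (E d × E d)))
  have hfin : eLpNormEssSup a (volume : Measure (E d × E d)) ≠ ⊤ := by
    rw [← eLpNorm_exponent_top]; exact Lp.eLpNorm_ne_top a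
  filter_upwards [Measure.ae_ae_of_ae_prod h] with x hx F hF
  refine hF.bdd_mul (c := (eLpNormEssSup a (volume : Measure (E d × E d))).toReal) ?_ ?_
  · exact ((Lp.stronglyMeasurable a).comp_measurable measurable_prodMk_left).aestronglyMeasurable
  · filter_upwards [hx] with ξ hξ
    rw [← toReal_enorm]
    exact ENNReal.toReal_mono hfin hξ

/-- The decomposition of a symbol along `HS₀(M) ⊕ B` is unique. -/
theorem decomposition_unique [Nontrivial (E d)] {M : E d → E d} (hM : Measurable M)
    {a a₀ b a₀' b' : Linf d} (h : Decomposes M a a₀ b) (h' : Decomposes M a a₀' b')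
    {β β' : Lp ℂ ∞ (volume : Measure (E d))} (hβ : HasProfile b β) (hβ' : HasProfile b' β') :
    a₀ = a₀' ∧ β =ᵐ[volume] β' := by
  obtain ⟨g, ⟨hg, hgr⟩, -⟩ := h.1
  obtain ⟨g', ⟨hg', hgr'⟩, -⟩ := h'.1
  have hsum : a₀ + b = a₀' + b' := h.2.2.symm.trans h'.2.2
  have hae : ∀ᵐ z : E d × E d, a₀ z - a₀' z = β' z.1 - β z.1 := by
    have h1 := Lp.coeFn_add a₀ b
    have h2 := Lp.coeFn_add a₀' b'
    rw [← hsum] at h2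
    filter_upwards [h1, h2, hβ, hβ'] with z z1 z2 z3 z4
    rw [z1] at z2
    simp only [Pi.add_apply] at z2
    rw [← z3, ← z4, sub_eq_sub_iff_add_eq_add, z2]
    ring
  have hββ' : β =ᵐ[volume] β' := by
    filter_upwards [hgr, hgr', Measure.ae_ae_of_ae_prod hae, ae_integrable_partialFourier hM hg,
      ae_integrable_partialFourier hM hg', ae_integrable_mul_of_linf a₀,
      ae_integrable_mul_of_linf a₀'] with x x1 x2 x3 x4 x5 x6 x7
    set t : ℂ := (((2 * Real.pi) ^ ((d : ℝ) / 2) : ℝ) : ℂ)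
    have ht : t ≠ 0 := by
      have : (0 : ℝ) < (2 * Real.pi) ^ ((d : ℝ) / 2) := by positivity
      exact Complex.ofReal_ne_zero.2 this.ne'
    -- The difference of the two slices is constant in ξ, so its Fourier transform is a multiple of
    -- the Dirac mass; it is also an integrable function, hence the multiple vanishes.
    have hz : (β' x - β x) * t = 0 := by
      refine eq_zero_of_integral_eq_eval (x4.sub x5) fun ψ => ?_
      have hψ := integrable_fourierInt ψ
      have hbd : ∀ {H : E d → ℂ}, Integrable H → Integrable fun k => H k * ψ k := fun hH =>
        hH.mul_bdd (c := ‖ψ.toBoundedContinuousFunction‖) ψ.continuous.aestronglyMeasurable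
          (.of_forall fun k => ψ.toBoundedContinuousFunction.norm_coe_le_norm k)
      calc ∫ k, ((fun k => partialFourier M g x k) - fun k => partialFourier M g' x k) k * ψ k
          = ∫ k, partialFourier M g x k * ψ k - partialFourier M g' x k * ψ k := by
            simp only [Pi.sub_apply, sub_mul]
        _ = slicePairing a₀ x (fourierInt ψ) - slicePairing a₀' x (fourierInt ψ) := by
            rw [integral_sub (hbd x4) (hbd x5), x1, x2]
        _ = ∫ ξ, (β' x - β x) * fourierInt ψ ξ := by
            rw [slicePairing, slicePairing, ← integral_sub (x6 _ hψ) (x7 _ hψ)]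
            refine integral_congr_ae (x3.mono fun ξ hξ => ?_)
            simp only [← hξ, sub_mul]
        _ = _ := by rw [integral_const_mul, integral_fourierInt]; ring
    have := (mul_eq_zero.1 hz).resolve_right ht
    exact (sub_eq_zero.1 this).symm
  refine ⟨?_, hββ'⟩
  have hb : b = b' := by
    refine Lp.ext ?_
    have h1 : ∀ᵐ z : E d × E d, β z.1 = β' z.1 := Measure.quasiMeasurePreserving_fst.ae hββ'
    filter_upwards [hβ, hβ', h1] with z z1 z2 z3
    rw [z1, z2, z3]
  rw [hb] at hsum
  exact add_right_cancel hsum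

end DirectSum

/-! ### The weighted measure -/

section Weight

variable {d : ℕ}

theorem ae_weightMeasure {φ : E d → ℝ} (hφ : Continuous φ) :
    ae (weightMeasure φ) = ae (volume : Measure (E d)) := by
  refine le_antisymm (withDensity_absolutelyContinuous _ _).ae_le
    (withDensity_absolutelyContinuous' (by fun_prop) (.of_forall fun x => ?_)).ae_le
  simp [Real.exp_pos]

theorem lintegral_weightMeasure {φ : E d → ℝ} (hφ : Continuous φ) (h : E d → ℝ≥0∞) :
    ∫⁻ x, h x ∂weightMeasure φ = ∫⁻ x, ENNReal.ofReal (Real.exp (-φ x)) * h x :=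
  lintegral_withDensity_eq_lintegral_mul_non_measurable _ (by fun_prop) (by simp) h

/-- The weight `exp(-φ/q)`. -/
def weight (φ : E d → ℝ) (q : ℝ) (x : E d) : ℝ≥0∞ := ENNReal.ofReal (Real.exp (-φ x / q))

/-- The modulus of `exp(-φ/q) f`. -/
def weighted (φ : E d → ℝ) (q : ℝ) (f : E d → ℂ) (x : E d) : ℝ≥0∞ := weight φ q x * ‖f x‖ₑ

theorem weight_ne_zero (φ : E d → ℝ) (q : ℝ) (x : E d) : weight φ q x ≠ 0 := by
  simp [weight, Real.exp_pos]

theorem weight_ne_top (φ : E d → ℝ) (q : ℝ) (x : E d) : weight φ q x ≠ ⊤ := ENNReal.ofReal_ne_top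

theorem weight_rpow (φ : E d → ℝ) {q : ℝ} (hq : 0 < q) (x : E d) :
    weight φ q x ^ q = ENNReal.ofReal (Real.exp (-φ x)) := by
  rw [weight, ENNReal.ofReal_rpow_of_pos (Real.exp_pos _), ← Real.exp_mul,
    div_mul_cancel₀ _ hq.ne']

theorem measurable_weighted {φ : E d → ℝ} (hφ : Continuous φ) (q : ℝ) {f : E d → ℂ}
    (hf : Measurable f) : Measurable (weighted φ q f) := by
  unfold weighted weight
  fun_prop

theorem lintegral_weighted_rpow {φ : E d → ℝ} (hφ : Continuous φ) {q : ℝ} (hq : 0 < q)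
    (f : E d → ℂ) : ∫⁻ x, weighted φ q f x ^ q = ∫⁻ x, ‖f x‖ₑ ^ q ∂weightMeasure φ := by
  rw [lintegral_weightMeasure hφ]
  refine lintegral_congr fun x => ?_
  rw [weighted, ENNReal.mul_rpow_of_nonneg _ _ hq.le, weight_rpow φ hq]

/-- The weight does not depend on `n`, so it factors out of the square function and the problem
passes to Lebesgue measure. -/
theorem squareIntegral_weightMeasure {φ : E d → ℝ} (hφ : Continuous φ) {p : ℝ≥0∞}
    [Fact (1 ≤ p)] (hq : 0 < p.toReal) {N : ℕ} (f : Fin N → Lp ℂ p (weightMeasure φ)) :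
    squareIntegral f = ∫⁻ x, (∑ n, weighted φ p.toReal (f n) x ^ 2) ^ (p.toReal / 2) := by
  rw [squareIntegral, lintegral_weightMeasure hφ]
  refine lintegral_congr fun x => ?_
  simp only [weighted, mul_pow, ← Finset.mul_sum]
  rw [ENNReal.mul_rpow_of_nonneg _ _ (by positivity), sq_rpow_half, weight_rpow φ hq]

/-- The core is dense in `L^p`. -/
theorem dense_core {φ : E d → ℝ} (hφ : Continuous φ) {p : ℝ≥0∞} [Fact (1 ≤ p)] (hp : p ≠ ⊤) :
    Dense {f : Lp ℂ p (weightMeasure φ) | ∃ f₀ ∈ core φ, f =ᵐ[weightMeasure φ] f₀} := by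
  have hp1 : 1 ≤ p := Fact.out
  have hp0 : p ≠ 0 := (zero_lt_one.trans_le hp1).ne'
  set q := p.toReal
  have hq : 0 < q := ENNReal.toReal_pos hp0 hp
  -- With this potential, multiplication by exp(-φ/2) is an isometry from L^p(exp(-φ)dx) to
  -- L^p(exp(-ψ)dx) that sends the core to smooth compactly supported functions, whose density is
  -- standard.
  set ψ : E d → ℝ := fun x => φ x - q * φ x / 2
  have hψ : Continuous ψ := by fun_prop
  have hloc : IsLocallyFiniteMeasure (weightMeasure ψ) :=
    IsLocallyFiniteMeasure.withDensity_ofReal (by fun_prop)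
  have hnorm : ∀ F : E d → ℂ,
      eLpNorm (fun x => F x * (Real.exp (-φ x / 2) : ℂ)) p (weightMeasure ψ) =
        eLpNorm F p (weightMeasure φ) := by
    intro F
    rw [eLpNorm_eq_lintegral_rpow_enorm_toReal hp0 hp,
      eLpNorm_eq_lintegral_rpow_enorm_toReal hp0 hp, lintegral_weightMeasure hφ, lintegral_weightMeasure hψ]
    congr 1
    refine lintegral_congr fun x => ?_
    rw [enorm_mul, ENNReal.mul_rpow_of_nonneg _ _ hq.le, ← ofReal_norm (Real.exp _ : ℂ),
      Complex.norm_real, Real.norm_of_nonneg (Real.exp_pos _).le,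
      ENNReal.ofReal_rpow_of_pos (Real.exp_pos _), ← Real.exp_mul,
      mul_comm (‖F x‖ₑ ^ q), ← mul_assoc, ← ENNReal.ofReal_mul (Real.exp_pos _).le, ← Real.exp_add]
    congr 3
    simp only [ψ, q]
    ring
  intro f
  refine (mem_closure_iff_nhds_basis Metric.nhds_basis_closedBall).2 fun δ hδ => ?_
  set h : E d → ℂ := fun x => f x * (Real.exp (-φ x / 2) : ℂ)
  have hmeas : ∀ {F : E d → ℂ}, AEStronglyMeasurable F (weightMeasure φ) →
      AEStronglyMeasurable (fun x => F x * (Real.exp (-φ x / 2) : ℂ)) (weightMeasure ψ) := by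
    intro F hF
    have h1 : AEStronglyMeasurable F (weightMeasure ψ) :=
      hF.mono_ac (Measure.ae_le_iff_absolutelyContinuous.1
        (by rw [ae_weightMeasure hφ, ae_weightMeasure hψ]))
    exact h1.mul (by fun_prop : Continuous fun x => (Real.exp (-φ x / 2) : ℂ)).aestronglyMeasurable
  have hh : MemLp h p (weightMeasure ψ) :=
    ⟨hmeas (Lp.aestronglyMeasurable f), by rw [hnorm]; exact Lp.eLpNorm_lt_top f⟩
  obtain ⟨k, hk1, hk2, hk3⟩ := hh.exist_eLpNorm_sub_le hp hp1 hδ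
  set f₀ : E d → ℂ := fun x => k x * (Real.exp (φ x / 2) : ℂ)
  have hf₀ : (fun x => f₀ x * (Real.exp (-φ x / 2) : ℂ)) = k := by
    ext x
    simp only [f₀]
    rw [mul_assoc, ← Complex.ofReal_mul, ← Real.exp_add, neg_div, add_neg_cancel, Real.exp_zero,
      Complex.ofReal_one, mul_one]
  have hf₀m : AEStronglyMeasurable f₀ (weightMeasure φ) :=
    (hk2.continuous.mul (by fun_prop)).aestronglyMeasurable
  have hsub : eLpNorm (⇑f - f₀) p (weightMeasure φ) ≤ ENNReal.ofReal δ := by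
    rw [← hnorm]
    convert hk3 using 2
    ext x
    simp only [Pi.sub_apply, sub_mul, h]
    rw [← congrFun hf₀ x]
  have hf₀p : MemLp f₀ p (weightMeasure φ) := by
    have h1 : MemLp (⇑f - f₀) p (weightMeasure φ) :=
      ⟨(Lp.aestronglyMeasurable f).sub hf₀m, hsub.trans_lt ENNReal.ofReal_lt_top⟩
    simpa using (Lp.memLp f).sub h1
  refine ⟨hf₀p.toLp f₀, ⟨f₀, ⟨by rw [hf₀]; exact hk2, by rw [hf₀]; exact hk1⟩,
    hf₀p.coeFn_toLp⟩, ?_⟩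
  rw [Metric.mem_closedBall, dist_comm, dist_eq_norm, Lp.norm_def]
  refine ENNReal.toReal_le_of_le_ofReal hδ.le ?_
  refine (eLpNorm_congr_ae ?_).trans_le hsub
  refine (Lp.coeFn_sub _ _).trans ?_
  filter_upwards [hf₀p.coeFn_toLp] with x hx
  simp [hx]

end Weight

/-! ### The Weyl operators -/

section WeylOperator

variable {d : ℕ}

/-- The integral kernel of `a₀(Q,P)`. -/
def weylKernel (c : ℝ) (φ : E d → ℝ) (M : E d → E d) (g : E d × E d →ₘ[volume] ℂ) (x y : E d) :
    ℂ :=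
  (((2 * Real.pi) ^ (-(d : ℝ) / 2) * (c ^ d)⁻¹ : ℝ) : ℂ) *
    (partialFourier M g ((2 * c)⁻¹ • (x + y)) (c⁻¹ • (x - y)) *
      (Real.exp ((φ y - φ x) / 2) : ℂ))

theorem kernelAction_eq (c : ℝ) (φ : E d → ℝ) (M : E d → E d) (g : E d × E d →ₘ[volume] ℂ)
    (f : E d → ℂ) (y : E d) :
    kernelAction c φ M g f y = ∫ x, weylKernel c φ M g x y * f x := by
  rw [kernelAction, ← integral_const_mul]
  simp only [weylKernel, mul_assoc]

/-- The action of `a(Q,P)` on functions. -/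
def weylAction (c : ℝ) (φ : E d → ℝ) (M : E d → E d) (g : E d × E d →ₘ[volume] ℂ)
    (β : E d → ℂ) (f : E d → ℂ) (y : E d) : ℂ :=
  kernelAction c φ M g f y + β (c⁻¹ • y) * f y

theorem weylAction_congr (c : ℝ) (φ : E d → ℝ) (M : E d → E d) (g : E d × E d →ₘ[volume] ℂ)
    (β : E d → ℂ) {f f' : E d → ℂ} (h : f =ᵐ[volume] f') :
    weylAction c φ M g β f =ᵐ[volume] weylAction c φ M g β f' := by
  filter_upwards [h] with y hy
  rw [weylAction, weylAction, hy, kernelAction_eq, kernelAction_eq]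
  congr 1
  exact integral_congr_ae (h.mono fun x hx => by simp only [hx])

theorem measurable_weylKernel (c : ℝ) {φ : E d → ℝ} (hφ : Continuous φ) {M : E d → E d}
    (hM : Measurable M) (g : E d × E d →ₘ[volume] ℂ) :
    Measurable fun z : E d × E d => weylKernel c φ M g z.2 z.1 := by
  have h1 : Measurable fun z : E d × E d =>
      partialFourier M g ((2 * c)⁻¹ • (z.2 + z.1)) (c⁻¹ • (z.2 - z.1)) :=
    (stronglyMeasurable_partialFourier hM g).measurable.comp
      (g := fun z : E d × E d => partialFourier M g z.1 z.2)
      (f := fun z : E d × E d => ((2 * c)⁻¹ • (z.2 + z.1), c⁻¹ • (z.2 - z.1))) (by fun_prop)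
  exact (h1.mul (by fun_prop)).const_mul _

theorem measurable_weylAction (c : ℝ) {φ : E d → ℝ} (hφ : Continuous φ) {M : E d → E d}
    (hM : Measurable M) (g : E d × E d →ₘ[volume] ℂ) {β : E d → ℂ} (hβ : Measurable β)
    {f : E d → ℂ} (hf : Measurable f) : Measurable (weylAction c φ M g β f) := by
  have h1 : StronglyMeasurable fun y => ∫ x, weylKernel c φ M g x y * f x :=
    StronglyMeasurable.integral_prod_right'
      (f := fun z : E d × E d => weylKernel c φ M g z.2 z.1 * f z.2)
      ((measurable_weylKernel c hφ hM g).mul (hf.comp measurable_snd)).stronglyMeasurable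
  simp only [← kernelAction_eq] at h1
  exact h1.measurable.add ((hβ.comp (measurable_const_smul _)).mul hf)

/-- The growth condition compensates the change of weights. -/
theorem enorm_weylKernel_mul_weight_le {c : ℝ} (hc : 0 < c) {φ : E d → ℝ} {p : ℝ≥0∞}
    {M : E d → E d} {ε : ℝ} (hM : ValidGrowthPair c φ p M ε) (g : E d × E d →ₘ[volume] ℂ)
    (x y : E d) :
    weight φ p.toReal y * ‖weylKernel c φ M g x y‖ₑ ≤
      ENNReal.ofReal (Real.exp ε) * ENNReal.ofReal (c ^ d)⁻¹ *
        ‖g ((2 * c)⁻¹ • (x + y), c⁻¹ • (x - y))‖ₑ * weight φ p.toReal x := by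
  set q := p.toReal
  set I : ℝ := inner ℝ (M ((2 * c)⁻¹ • (x + y))) (c⁻¹ • (x - y))
  set γ := ‖g ((2 * c)⁻¹ • (x + y), c⁻¹ • (x - y))‖
  have hgrow : |1 / 2 - q⁻¹| * |φ x - φ y| - |I| ≤ ε := by
    have := (abs_le.1 (hM.2.2 x y)).2
    rwa [real_inner_comm] at this
  have h2pi : (0 : ℝ) < 2 * Real.pi := by positivity
  have hpp : (2 * Real.pi) ^ (-(d : ℝ) / 2) * (2 * Real.pi) ^ ((d : ℝ) / 2) = 1 := by
    rw [← Real.rpow_add h2pi, neg_div, neg_add_cancel, Real.rpow_zero]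
  have hk : ‖weylKernel c φ M g x y‖ =
      (c ^ d)⁻¹ * γ * (Real.exp (-|I|) * Real.exp ((φ y - φ x) / 2)) := by
    rw [weylKernel, partialFourier]
    have h1 : ‖(c ^ d)⁻¹‖ = (c ^ d)⁻¹ := Real.norm_of_nonneg (by positivity)
    have h2 : ∀ t : ℝ, ‖(2 * Real.pi) ^ t‖ = (2 * Real.pi) ^ t := fun t =>
      Real.norm_of_nonneg (by positivity)
    have h3 : ∀ t : ℝ, ‖Real.exp t‖ = Real.exp t := fun t => Real.norm_of_nonneg (Real.exp_pos t).le
    simp only [norm_mul, Complex.norm_real, h2, h3]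
    rw [h1]
    calc _ = ((2 * Real.pi) ^ (-(d : ℝ) / 2) * (2 * Real.pi) ^ ((d : ℝ) / 2)) *
          ((c ^ d)⁻¹ * γ * (Real.exp (-|I|) * Real.exp ((φ y - φ x) / 2))) := by ring
      _ = _ := by rw [hpp, one_mul]
  -- Conjugation by exp(-φ/q) leaves the exponent (1/2 - 1/q)(φ y - φ x), which the growth condition
  -- bounds by |I| + ε.
  have hexp : Real.exp (-φ y / q) * (Real.exp (-|I|) * Real.exp ((φ y - φ x) / 2)) ≤
      Real.exp ε * Real.exp (-φ x / q) := by
    rw [← Real.exp_add, ← Real.exp_add, ← Real.exp_add, Real.exp_le_exp]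
    have h1 : (1 / 2 - q⁻¹) * (φ y - φ x) ≤ |1 / 2 - q⁻¹| * |φ x - φ y| := by
      rw [abs_sub_comm (φ x), ← abs_mul]
      exact le_abs_self _
    have h2 : -φ y / q + (φ y - φ x) / 2 + φ x / q = (1 / 2 - q⁻¹) * (φ y - φ x) := by ring
    have h3 : -φ x / q = -(φ x / q) := by ring
    linarith
  rw [weight, weight, ← ofReal_norm, ← ofReal_norm, hk, ← ENNReal.ofReal_mul (by positivity),
    ← ENNReal.ofReal_mul (by positivity), ← ENNReal.ofReal_mul (by positivity),
    ← ENNReal.ofReal_mul (by positivity)]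
  refine ENNReal.ofReal_le_ofReal ?_
  calc _ = (c ^ d)⁻¹ * γ *
        (Real.exp (-φ y / q) * (Real.exp (-|I|) * Real.exp ((φ y - φ x) / 2))) := by ring
    _ ≤ (c ^ d)⁻¹ * γ * (Real.exp ε * Real.exp (-φ x / q)) := by gcongr
    _ = _ := by ring

/-- `S` majorizes the Weyl operator after conjugation with the weight. -/
def IsWeylMajorant (c : ℝ) (φ : E d → ℝ) (M : E d → E d) (q : ℝ) (g : E d × E d →ₘ[volume] ℂ)
    (β : E d → ℂ) (S : (E d → ℝ≥0∞) → E d → ℝ≥0∞) : Prop :=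
  ∀ f : E d → ℂ, Measurable f → ∀ᵐ y : E d,
    weight φ q y * ((∫⁻ x, ‖weylKernel c φ M g x y * f x‖ₑ) + ‖β (c⁻¹ • y) * f y‖ₑ) ≤
      S (weighted φ q f) y

/-- The midpoint and difference coordinates are nonsingular. -/
theorem quasiMeasurePreserving_midpoint_sub {c : ℝ} (hc : 0 < c) :
    Measure.QuasiMeasurePreserving (fun z : E d × E d =>
      ((2 * c)⁻¹ • (z.2 + z.1), c⁻¹ • (z.2 - z.1))) volume volume := by
  let f : (E d × E d) →ₗ[ℝ] (E d × E d) :=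
    ((2 * c)⁻¹ • (LinearMap.snd ℝ (E d) (E d) + LinearMap.fst ℝ (E d) (E d))).prod
      (c⁻¹ • (LinearMap.snd ℝ (E d) (E d) - LinearMap.fst ℝ (E d) (E d)))
  have hinj : LinearMap.ker f = ⊥ := by
    rw [LinearMap.ker_eq_bot']
    rintro ⟨y, x⟩ h
    have h' : (2 * c)⁻¹ • (x + y) = 0 ∧ c⁻¹ • (x - y) = 0 := by simpa [f] using h
    have h1 : x + y = 0 := (smul_eq_zero.1 h'.1).resolve_left (by positivity)
    have h2 : x = y := sub_eq_zero.1 ((smul_eq_zero.1 h'.2).resolve_left (by positivity))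
    rw [h2, ← two_smul ℝ] at h1
    have h3 : y = 0 := (smul_eq_zero.1 h1).resolve_left two_ne_zero
    rw [h2, h3]; rfl
  have hdet : LinearMap.det f ≠ 0 := by
    rw [← isUnit_iff_ne_zero, ← LinearMap.isUnit_iff_isUnit_det, LinearMap.isUnit_iff_ker_eq_bot]
    exact hinj
  have : (volume : Measure (E d × E d)).IsAddHaarMeasure :=
    Measure.prod.instIsAddHaarMeasure (volume : Measure (E d)) (volume : Measure (E d))
  exact Measure.LinearMap.quasiMeasurePreserving (volume : Measure (E d × E d)) f hdet

/-- Symbols with uniformly bounded radial majorants have uniformly dominated Weyl operators. -/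
theorem exists_isWeylMajorant (hd : 0 < d) {c : ℝ} (hc : 0 < c) {φ : E d → ℝ}
    {p : ℝ≥0∞} {M : E d → E d} {ε : ℝ} (hM : ValidGrowthPair c φ p M ε) (K κ : ℝ≥0) :
    ∃ L : ℝ≥0, ∀ (g : E d × E d →ₘ[volume] ℂ) (G : E d → ℝ) (β : E d → ℂ), Dominates G g →
      radialMajorantIntegral G ≤ K → (∀ᵐ x, ‖β x‖ₑ ≤ κ) →
      ∃ S, MaximallyDominated volume L S ∧ IsWeylMajorant c φ M p.toReal g β S := by
  obtain ⟨L, hL⟩ := exists_mixtureOp_majorant hd hc κ (Real.exp ε).toNNReal K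
  refine ⟨L, fun g G β hg hG hβ => ?_⟩
  obtain ⟨ρ, s, hρ, hdom, hker⟩ := hL G hG
  refine ⟨_, hdom, fun f hf => ?_⟩
  set q := p.toReal
  -- Domination holds only almost everywhere in (x, k), so it is pulled back along the nonsingular
  -- change of coordinates before slicing.
  have hg' : ∀ᵐ z : E d × E d, ‖g ((2 * c)⁻¹ • (z.2 + z.1), c⁻¹ • (z.2 - z.1))‖ <
      G (c⁻¹ • (z.2 - z.1)) := (quasiMeasurePreserving_midpoint_sub hc).ae hg.2
  have hβ' : ∀ᵐ y : E d, ‖β (c⁻¹ • y)‖ₑ ≤ κ :=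
    (Measure.quasiMeasurePreserving_smul volume (inv_ne_zero hc.ne')).ae hβ
  filter_upwards [Measure.ae_ae_of_ae_prod hg', hβ'] with y hy hβy
  have hker' : ∀ᵐ x : E d, ENNReal.ofReal (Real.exp ε) * ENNReal.ofReal (c ^ d)⁻¹ *
      ‖G (c⁻¹ • (x - y))‖ₑ ≤ ballMixture volume ρ s (x - y) :=
    (measurePreserving_sub_right volume y).quasiMeasurePreserving.ae hker
  rw [mul_add, mixtureOp, add_comm]
  refine add_le_add ?_ ?_
  · rw [enorm_mul, weighted, mul_left_comm]
    gcongr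
  · rw [← lintegral_const_mul' _ _ (weight_ne_top φ q y)]
    refine lintegral_mono_ae ?_
    filter_upwards [hy, hker'] with x hx hx'
    have hgG : ‖g ((2 * c)⁻¹ • (x + y), c⁻¹ • (x - y))‖ₑ ≤ ‖G (c⁻¹ • (x - y))‖ₑ := by
      rw [← ofReal_norm, ← ofReal_norm]
      exact ENNReal.ofReal_le_ofReal (hx.le.trans (le_abs_self _))
    calc weight φ q y * ‖weylKernel c φ M g x y * f x‖ₑ
        = weight φ q y * ‖weylKernel c φ M g x y‖ₑ * ‖f x‖ₑ := by rw [enorm_mul, mul_assoc]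
      _ ≤ ENNReal.ofReal (Real.exp ε) * ENNReal.ofReal (c ^ d)⁻¹ *
            ‖g ((2 * c)⁻¹ • (x + y), c⁻¹ • (x - y))‖ₑ * weight φ q x * ‖f x‖ₑ := by
          gcongr ?_ * ‖f x‖ₑ
          exact enorm_weylKernel_mul_weight_le hc hM g x y
      _ ≤ ENNReal.ofReal (Real.exp ε) * ENNReal.ofReal (c ^ d)⁻¹ *
            ‖G (c⁻¹ • (x - y))‖ₑ * weight φ q x * ‖f x‖ₑ := by gcongr
      _ ≤ ballMixture volume ρ s (x - y) * weight φ q x * ‖f x‖ₑ := by gcongr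
      _ = _ := by rw [weighted, mul_assoc]

theorem IsWeylMajorant.weighted_weylAction_le {c : ℝ} {φ : E d → ℝ} {M : E d → E d} {q : ℝ}
    {g : E d × E d →ₘ[volume] ℂ} {β : E d → ℂ} {S : (E d → ℝ≥0∞) → E d → ℝ≥0∞}
    (h : IsWeylMajorant c φ M q g β S) {f : E d → ℂ} (hf : Measurable f) :
    ∀ᵐ y : E d, weighted φ q (weylAction c φ M g β f) y ≤ S (weighted φ q f) y := by
  filter_upwards [h f hf] with y hy
  refine le_trans ?_ hy
  rw [weighted, weylAction, kernelAction_eq]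
  gcongr
  refine (enorm_add_le _ _).trans ?_
  gcongr
  exact enorm_integral_le_lintegral_enorm _

/-- A majorized Weyl operator is integrable on `L^q`. -/
theorem IsWeylMajorant.ae_integrable {c : ℝ} {φ : E d → ℝ} (hφ : Continuous φ) {M : E d → E d}
    (hM : Measurable M) {q : ℝ} (hq : 0 < q)
    {g : E d × E d →ₘ[volume] ℂ} {β : E d → ℂ} {S : (E d → ℝ≥0∞) → E d → ℝ≥0∞}
    (h : IsWeylMajorant c φ M q g β S) {f : E d → ℂ} (hf : Measurable f)
    (hSm : Measurable (S (weighted φ q f))) (hS : ∫⁻ y, S (weighted φ q f) y ^ q ≠ ⊤) :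
    ∀ᵐ y : E d, Integrable fun x => weylKernel c φ M g x y * f x := by
  filter_upwards [h f hf, ae_lt_top (hSm.pow_const q) hS] with y hy hy'
  refine ⟨?_, ?_⟩
  · exact (((measurable_weylKernel c hφ hM g).comp measurable_prodMk_left).mul
      hf).aestronglyMeasurable
  -- The majorant controls the integral of the modulus, not merely the modulus of the integral, so
  -- its finiteness yields absolute convergence.
  · have h1 : S (weighted φ q f) y < ⊤ := (ENNReal.rpow_lt_top_iff_of_pos hq).1 hy'
    have h2 := ENNReal.lt_top_of_mul_ne_top_right (hy.trans_lt h1).ne (weight_ne_zero φ q y)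
    exact le_self_add.trans_lt h2

variable {p : ℝ≥0∞}

theorem measurable_coeFn {φ : E d → ℝ} (f : Lp ℂ p (weightMeasure φ)) : Measurable f :=
  (Lp.stronglyMeasurable f).measurable

variable [Fact (1 ≤ p)]

theorem lintegral_weighted_coeFn {φ : E d → ℝ} (hφ : Continuous φ) (hp0 : p ≠ 0) (hp : p ≠ ⊤)
    (f : Lp ℂ p (weightMeasure φ)) :
    ∫⁻ x, weighted φ p.toReal f x ^ p.toReal = ‖f‖ₑ ^ p.toReal := by
  rw [lintegral_weighted_rpow hφ (ENNReal.toReal_pos hp0 hp), enorm_rpow_eq_lintegral hp0 hp]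

/-- A majorized Weyl operator defines a bounded operator on `L^p`. -/
theorem IsWeylMajorant.exists_operator (hd : 0 < d) {c : ℝ} {φ : E d → ℝ} (hφ : Continuous φ)
    {M : E d → E d} (hM : Measurable M) (hp1 : 1 < p) (hp : p ≠ ⊤) {g : E d × E d →ₘ[volume] ℂ}
    {β : E d → ℂ} (hβ : Measurable β) {L : ℝ≥0} {S : (E d → ℝ≥0∞) → E d → ℝ≥0∞}
    (hS : MaximallyDominated volume L S) (h : IsWeylMajorant c φ M p.toReal g β S) :
    ∃ T : Lp ℂ p (weightMeasure φ) →L[ℂ] Lp ℂ p (weightMeasure φ),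
      ∀ f : Lp ℂ p (weightMeasure φ), T f =ᵐ[volume] weylAction c φ M g β f := by
  have : Nonempty (Fin d) := ⟨⟨0, hd⟩⟩
  have hp0 : p ≠ 0 := (zero_lt_one.trans hp1).ne'
  set q := p.toReal
  have hq1 : 1 < q := by
    rw [← ENNReal.toReal_one]; exact ENNReal.toReal_strict_mono hp hp1
  have hq0 : 0 < q := by linarith
  obtain ⟨C, hC, hSC⟩ :=
    MaximallyDominated.exists_lintegral_rpow_le (volume : Measure (E d)) L hq1
  have hae := ae_weightMeasure hφ
  have hSf : ∀ f : Lp ℂ p (weightMeasure φ),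
      ∫⁻ y, S (weighted φ q f) y ^ q ≤ C * ‖f‖ₑ ^ q := fun f => by
    rw [← lintegral_weighted_coeFn hφ hp0 hp]
    exact hSC S hS _ (measurable_weighted hφ q (measurable_coeFn f))
  -- Additivity of `T₀` depends on this: a non-integrable integrand would have Bochner integral 0 by
  -- convention.
  have hint : ∀ f : Lp ℂ p (weightMeasure φ),
      ∀ᵐ y : E d, Integrable fun x => weylKernel c φ M g x y * f x := fun f =>
    h.ae_integrable hφ hM hq0 (measurable_coeFn f)
      (hS.measurable _ (measurable_weighted hφ q (measurable_coeFn f)))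
      (ne_top_of_le_ne_top (ENNReal.mul_ne_top hC
        (ENNReal.rpow_ne_top_of_nonneg hq0.le enorm_ne_top)) (hSf f))
  have hbound : ∀ f : Lp ℂ p (weightMeasure φ),
      eLpNorm (weylAction c φ M g β f) p (weightMeasure φ) ≤ C ^ (1 / q) * ‖f‖ₑ := by
    intro f
    rw [eLpNorm_eq_lintegral_rpow_enorm_toReal hp0 hp, ← lintegral_weighted_rpow hφ hq0]
    calc (∫⁻ x, weighted φ q (weylAction c φ M g β f) x ^ q) ^ (1 / q)
        ≤ (C * ‖f‖ₑ ^ q) ^ (1 / q) := by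
          gcongr
          refine (lintegral_mono_ae ?_).trans (hSf f)
          filter_upwards [h.weighted_weylAction_le (measurable_coeFn f)] with y hy
          gcongr
      _ = _ := by
          rw [ENNReal.mul_rpow_of_nonneg _ _ (by positivity), ← ENNReal.rpow_mul,
            mul_one_div_cancel hq0.ne', ENNReal.rpow_one]
  have hCq : C ^ (1 / q) ≠ ⊤ := ENNReal.rpow_ne_top_of_nonneg (by positivity) hC
  have hmem : ∀ f : Lp ℂ p (weightMeasure φ),
      MemLp (weylAction c φ M g β f) p (weightMeasure φ) := fun f =>
    ⟨(measurable_weylAction c hφ hM g hβ (measurable_coeFn f)).aestronglyMeasurable,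
      (hbound f).trans_lt (ENNReal.mul_lt_top hCq.lt_top enorm_lt_top)⟩
  let R : Lp ℂ p (weightMeasure φ) → Lp ℂ p (weightMeasure φ) := fun f => (hmem f).toLp _
  have hcoe : ∀ f : Lp ℂ p (weightMeasure φ),
      R f =ᵐ[volume] weylAction c φ M g β f := fun f => by
    rw [Filter.EventuallyEq, ← hae]
    exact (hmem f).coeFn_toLp
  let T₀ : Lp ℂ p (weightMeasure φ) →ₗ[ℂ] Lp ℂ p (weightMeasure φ) :=
    { toFun := R
      map_add' := fun f f' => by
        refine Lp.ext ?_
        rw [Filter.EventuallyEq, hae]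
        have h1 : (f + f' : Lp ℂ p (weightMeasure φ)) =ᵐ[volume] fun x => f x + f' x := by
          rw [Filter.EventuallyEq, ← hae]; exact Lp.coeFn_add f f'
        have h2 : (R f + R f' : Lp ℂ p (weightMeasure φ)) =ᵐ[volume]
            fun x => R f x + R f' x := by
          rw [Filter.EventuallyEq, ← hae]; exact Lp.coeFn_add _ _
        filter_upwards [hcoe (f + f'), hcoe f, hcoe f', h2, hint f, hint f',
          weylAction_congr c φ M g β h1] with y y1 y2 y3 y4 y5 y6 y7
        rw [y1, y4, y2, y3, y7]
        simp only [weylAction, kernelAction_eq, mul_add]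
        rw [integral_add y5 y6]
        ring
      map_smul' := fun t f => by
        refine Lp.ext ?_
        rw [Filter.EventuallyEq, hae]
        have h1 : (t • f : Lp ℂ p (weightMeasure φ)) =ᵐ[volume] fun x => t * f x := by
          rw [Filter.EventuallyEq, ← hae]; exact Lp.coeFn_smul t f
        have h2 : (t • R f : Lp ℂ p (weightMeasure φ)) =ᵐ[volume]
            fun x => t * R f x := by
          rw [Filter.EventuallyEq, ← hae]; exact Lp.coeFn_smul t _
        filter_upwards [hcoe (t • f), hcoe f, h2, weylAction_congr c φ M g β h1] with y y1 y2 y3 y4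
        rw [RingHom.id_apply, y1, y3, y2, y4]
        simp only [weylAction, kernelAction_eq, mul_left_comm _ t]
        rw [integral_const_mul]
        ring }
  refine ⟨T₀.mkContinuous (C ^ (1 / q)).toReal fun f => ?_, hcoe⟩
  have h1 : ‖R f‖ₑ ≤ C ^ (1 / q) * ‖f‖ₑ := by
    simp only [R]; rw [Lp.enorm_toLp]; exact hbound f
  have h2 := ENNReal.toReal_mono (ENNReal.mul_ne_top hCq enorm_ne_top) h1
  rwa [ENNReal.toReal_mul, toReal_enorm, toReal_enorm] at h2

end WeylOperator

/-! ### The operator family: uniqueness, uniform majorants, R-boundedness -/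

section Family

variable {d : ℕ} {p : ℝ≥0∞} [Fact (1 ≤ p)]

/-- The Weyl operator of a symbol is unique. -/
theorem isWeylOperator_unique (hd : 0 < d) {c : ℝ} (hc : 0 < c) {φ : E d → ℝ} (hφ : Continuous φ)
    {M : E d → E d} (hM : Measurable M) (hp : p ≠ ⊤) {a : Linf d}
    {T T' : Lp ℂ p (weightMeasure φ) →L[ℂ] Lp ℂ p (weightMeasure φ)}
    (hT : IsWeylOperator c φ M p a T) (hT' : IsWeylOperator c φ M p a T') : T = T' := by
  have : Nonempty (Fin d) := ⟨⟨0, hd⟩⟩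
  obtain ⟨a₀, b, g, β, hdec, hg, hβ, h⟩ := hT
  obtain ⟨a₀', b', g', β', hdec', hg', hβ', h'⟩ := hT'
  obtain ⟨ha, hββ'⟩ := decomposition_unique hM hdec hdec' hβ hβ'
  -- Once the first components agree, uniqueness of the representing function, part of the
  -- definition of `HSZero`, identifies the kernels.
  obtain rfl : g = g' := hdec.1.unique hg (ha ▸ hg')
  have hββ : ∀ᵐ y : E d, β (c⁻¹ • y) = β' (c⁻¹ • y) :=
    (Measure.quasiMeasurePreserving_smul volume (inv_ne_zero hc.ne')).ae hββ'
  rw [← ae_weightMeasure hφ] at hββ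
  refine ContinuousLinearMap.ext fun f => ?_
  refine congrFun (Continuous.ext_on (dense_core hφ hp) T.continuous T'.continuous ?_) f
  rintro f ⟨f₀, hf₀, hff₀⟩
  refine Lp.ext ?_
  filter_upwards [h f₀ hf₀ f hff₀, h' f₀ hf₀ f hff₀, hββ] with y y1 y2 y3
  rw [y1, y2, y3]

/-- The operator given by the kernel is a Weyl operator. -/
theorem isWeylOperator_of_coeFn {c : ℝ} {φ : E d → ℝ} (hφ : Continuous φ)
    {M : E d → E d} {a a₀ b : Linf d} (hdec : Decomposes M a a₀ b)
    {g : E d × E d →ₘ[volume] ℂ} (hg : Represents M a₀ g)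
    {β : Lp ℂ ∞ (volume : Measure (E d))} (hβ : HasProfile b β)
    {T : Lp ℂ p (weightMeasure φ) →L[ℂ] Lp ℂ p (weightMeasure φ)}
    (hT : ∀ f, T f =ᵐ[volume] weylAction c φ M g β f) : IsWeylOperator c φ M p a T := by
  refine ⟨a₀, b, g, β, hdec, hg, hβ, fun f₀ _ f hf => ?_⟩
  rw [Filter.EventuallyEq, ae_weightMeasure hφ] at hf ⊢
  exact (hT f).trans (weylAction_congr c φ M g β hf)

theorem ae_enorm_profile_le {b : Linf d} {β : Lp ℂ ∞ (volume : Measure (E d))}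
    (hβ : HasProfile b β) {κ : ℝ≥0} (hb : ‖b‖ ≤ κ) : ∀ᵐ x : E d, ‖β x‖ₑ ≤ κ := by
  have h1 := ae_le_eLpNormEssSup (f := b) (μ := (volume : Measure (E d × E d)))
  have h2 : eLpNormEssSup b (volume : Measure (E d × E d)) ≤ κ := by
    rw [← eLpNorm_exponent_top, ← Lp.enorm_def, ← ofReal_norm]
    exact ENNReal.ofReal_le_of_le_toReal (by simpa using hb)
  have h3 : ∀ᵐ z : E d × E d, ‖β z.1‖ₑ ≤ κ := by
    filter_upwards [h1, hβ] with z z1 z2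
    rw [← z2]
    exact z1.trans h2
  filter_upwards [Measure.ae_ae_of_ae_prod h3] with x hx
  -- The bound on the slice does not involve ξ, so a single point of the slice suffices.
  exact hx.exists.choose_spec

/-- The operators of the family are given by their kernels on all of `L^p` and uniformly
majorized. -/
theorem exists_majorized_weylOperator (hd : 0 < d) {c : ℝ} (hc : 0 < c) (hp1 : 1 < p) (hp : p ≠ ⊤)
    {φ : E d → ℝ} (hφ : Continuous φ) {M : E d → E d} {ε : ℝ} (hM : ValidGrowthPair c φ p M ε)
    {A : Set (Linf d)} (hA : A ⊆ HS M)
    (hG : ∃ K : ℝ≥0, ∀ g ∈ gParts M A, ∃ G : E d → ℝ,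
      Dominates G g ∧ radialMajorantIntegral G ≤ K)
    (hB : ∃ K : ℝ, ∀ b ∈ bParts M A, ‖b‖ ≤ K) :
    ∃ L : ℝ≥0, ∀ a ∈ A, ∃ (T : Lp ℂ p (weightMeasure φ) →L[ℂ] Lp ℂ p (weightMeasure φ))
      (S : (E d → ℝ≥0∞) → E d → ℝ≥0∞), IsWeylOperator c φ M p a T ∧
        MaximallyDominated volume L S ∧
        ∀ f, ∀ᵐ y, weighted φ p.toReal (T f) y ≤ S (weighted φ p.toReal f) y := by
  obtain ⟨K, hK⟩ := hG
  obtain ⟨κ, hκ⟩ := hB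
  obtain ⟨L, hL⟩ := exists_isWeylMajorant hd hc hM K κ.toNNReal
  refine ⟨L, fun a ha => ?_⟩
  obtain ⟨a₀, b, hdec⟩ := hA ha
  obtain ⟨g, hg, -⟩ := hdec.1
  obtain ⟨β, hβ⟩ := hdec.2.1
  obtain ⟨G, hGdom, hGK⟩ := hK g ⟨a, ha, a₀, b, hdec, hg⟩
  obtain ⟨S, hS, hmaj⟩ := hL g G β hGdom hGK
    (ae_enorm_profile_le hβ ((hκ b ⟨a, ha, a₀, hdec⟩).trans (Real.le_coe_toNNReal κ)))
  obtain ⟨T, hT⟩ := hmaj.exists_operator hd hφ hM.1 hp1 hp (Lp.stronglyMeasurable β).measurable hS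
  refine ⟨T, S, isWeylOperator_of_coeFn hφ hdec hg hβ hT, hS, fun f => ?_⟩
  filter_upwards [hT f, hmaj.weighted_weylAction_le (measurable_coeFn f)] with y y1 y2
  rw [weighted, y1]
  exact y2

/-- A uniformly majorized family is R-bounded. -/
theorem rBounded_of_majorized (hd : 0 < d) (hp1 : 1 < p) (hp : p ≠ ⊤) {φ : E d → ℝ}
    (hφ : Continuous φ) {𝒯 : Set (Lp ℂ p (weightMeasure φ) →L[ℂ] Lp ℂ p (weightMeasure φ))}
    {L : ℝ≥0} (h : ∀ T ∈ 𝒯, ∃ S : (E d → ℝ≥0∞) → E d → ℝ≥0∞, MaximallyDominated volume L S ∧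
      ∀ f, ∀ᵐ y, weighted φ p.toReal (T f) y ≤ S (weighted φ p.toReal f) y) : RBounded 𝒯 := by
  have : Nonempty (Fin d) := ⟨⟨0, hd⟩⟩
  have hp0 : p ≠ 0 := (zero_lt_one.trans hp1).ne'
  have hq1 : 1 < p.toReal := by
    rw [← ENNReal.toReal_one]; exact ENNReal.toReal_strict_mono hp hp1
  obtain ⟨C, hC, hsq⟩ :=
    MaximallyDominated.exists_squareFunction_le (volume : Measure (E d)) L hq1
  refine rBounded_of_squareIntegral_le hp1 hp 𝒯 hC fun N T f hT => ?_
  -- Each operator has its own majorant, but all share `L`, which alone determines the square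
  -- function constant.
  choose S hS hST using fun n => h (T n) (hT n)
  rw [squareIntegral_weightMeasure hφ (by linarith), squareIntegral_weightMeasure hφ (by linarith)]
  refine le_trans (lintegral_mono_ae ?_) (hsq N S (fun n => weighted φ p.toReal (f n)) hS
    (fun n => measurable_weighted hφ _ (measurable_coeFn (f n))) fun n => ?_)
  · filter_upwards [ae_all_iff.2 fun n => hST n (f n)] with y hy
    gcongr with n
    exact hy n
  · rw [lintegral_weighted_coeFn hφ hp0 hp]
    exact ENNReal.rpow_ne_top_of_nonneg (by linarith) enorm_ne_top

end Family

end WeylHS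

end

theorem mainTheorem12 {d : ℕ} (hd : 0 < d) (c : ℝ) (hc : 0 < c)
    (p : ℝ≥0∞) [Fact (1 ≤ p)] (hp_one : 1 < p) (hp_top : p < ⊤)
    (φ : WeylHS.E d → ℝ) (hφ : ContDiff ℝ 2 φ)
    (M : WeylHS.E d → WeylHS.E d) (ε : ℝ) (hM : WeylHS.ValidGrowthPair c φ p M ε)
    (A : Set (WeylHS.Linf d)) (hA : A ⊆ WeylHS.HS M)
    (hG : ∃ K : ℝ≥0, ∀ g ∈ WeylHS.gParts M A, ∃ G : WeylHS.E d → ℝ,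
      WeylHS.Dominates G g ∧ WeylHS.radialMajorantIntegral G ≤ K)
    (hB : ∃ K : ℝ, ∀ b ∈ WeylHS.bParts M A, ‖b‖ ≤ K) :
    (∀ a ∈ A, ∃! T, WeylHS.IsWeylOperator c φ M p a T) ∧
      WeylHS.RBounded (WeylHS.weylFamily c φ M p A) := by
  have hp := hp_top.ne
  have hφc := hφ.continuous
  obtain ⟨L, hL⟩ := WeylHS.exists_majorized_weylOperator hd hc hp_one hp hφc hM hA hG hB
  refine ⟨fun a ha => ?_, WeylHS.rBounded_of_majorized (L := L) hd hp_one hp hφc ?_⟩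
  · obtain ⟨T, -, hT, -⟩ := hL a ha
    exact ⟨T, hT, fun T' hT' => WeylHS.isWeylOperator_unique hd hc hφc hM.1 hp hT' hT⟩
  · rintro T ⟨a, ha, hT⟩
    obtain ⟨T', S, hT', hS, hTS⟩ := hL a ha
    obtain rfl := WeylHS.isWeylOperator_unique hd hc hφc hM.1 hp hT hT'
    exact ⟨S, hS, hTS⟩
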